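/- For $r\ge 1$ and non-negative integers $k_1,\dots,k_r$, let the normalized multiple Bernoulli polynomials $\zeta(-k_1,\dots,-k_r|z)\in\mathbb{Q}[z]$ be defined recursively by $\zeta(-k|z)=-\frac{B_{k+1}(z)}{k+1}$ and, for $r\ge 2$, $$\zeta(-k_1,\dots,-k_r|z)=-\tfrac{1}{k_r+1}\,\zeta(-k_1,\dots,-k_{r-2},-k_{r-1}-k_r-1|z)-\tfrac12\,\zeta(-k_1,\dots,-k_{r-2},-k_{r-1}-k_r|z)+\sum_{q=1}^{k_r}(-k_r)_q\frac{B_{q+1}}{(q+1)!}\,\zeta(-k_1,\dots,-k_{r-2},-k_{r-1}-k_r+q|z),$$ where $B_n(z)$ are the Bernoulli polynomials, $B_n=B_n(0)$, and $(x)_q=x(x+1)\cdots(x+q-1)$. Theorem. For every $r\ge 1$, the series $$\sum_{0<n_1<\cdots<n_r}\frac{1}{n_1^{s_1}\cdots n_r^{s_r}},$$ which converges absolutely for $\operatorname{Re}(s_j+\cdots+s_r)>r-j+1$ $(1\le j\le r)$, has a meromorphic continuation $\zeta(s_1,\dots,s_r)$ to $\mathbb{C}^r$, and for all non-negative integers $k_1,\dots,k_r$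 the iterated limit below (the limit in $s_r$ being taken first and that in $s_1$ last, each over a punctured neighbourhood) exists and $$\zeta(-k_1,\dots,-k_r|1)=\lim_{s_1\to -k_1}\cdots\lim_{s_r\to -k_r}\zeta(s_1,\dots,s_r).$$ -/

import Mathlib

open Filter Topology Polynomial

namespace PolyZeta

/-- The normalized multiple Bernoulli polynomial `ζ(-k₁, …, -k_{r+1} | z)`, as a polynomial in `z`.
In depth one it is `-B_{k+1}(z) / (k+1)`.  In depth at least two, with `a` and `b` the last two
entries of `k`, it is a combination of polynomials of depth one less, in which `a` and `b` are
replaced by the single entry `m` (`merged m`), for `m = a + b + 1`, `a + b` and `a + b - q` with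
`1 ≤ q ≤ b` (so the subtraction never truncates).  Here `(-b)_q` is the rising factorial. -/
noncomputable def nmbp : (r : ℕ) → (Fin (r + 1) → ℕ) → ℚ[X]
  | 0, k => C (-(1 / ((k 0 : ℚ) + 1))) * Polynomial.bernoulli (k 0 + 1)
  | r + 1, k =>
    let b : ℕ := k (Fin.last (r + 1))
    let a : ℕ := k (Fin.last r).castSucc
    let merged : ℕ → Fin (r + 1) → ℕ := fun m => Fin.snoc (Fin.init (Fin.init k)) m
    C (-(1 / ((b : ℚ) + 1))) * nmbp r (merged (a + b + 1))
      - C (1 / 2) * nmbp r (merged (a + b))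
      + ∑ q ∈ Finset.Icc 1 b,
          C ((ascPochhammer ℚ q).eval (-(b : ℚ)) * (_root_.bernoulli (q + 1) / (q + 1).factorial))
            * nmbp r (merged (a + b - q))

theorem ascPochhammer_mul_bernoulli {b q : ℕ} (hq : 1 ≤ q) (_hqb : q ≤ b) :
    (ascPochhammer ℚ q).eval (-(b : ℚ)) * (_root_.bernoulli (q + 1) / (q + 1).factorial) =
      -(1 / ((b : ℚ) + 1)) * (_root_.bernoulli (q + 1) * (b + 1).choose (q + 1)) := by
  rcases Nat.even_or_odd q with he | ho
  · rw [bernoulli_eq_zero_of_odd he.add_one (by omega)]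
    simp
  have hb : ((b : ℚ) + 1) ≠ 0 := by positivity
  have hf : ((q + 1).factorial : ℚ) ≠ 0 := by positivity
  have h2 : ((b + 1).choose (q + 1) : ℚ) = (b + 1) * b.descFactorial q / (q + 1).factorial := by
    rw [eq_div_iff hf]
    have := Nat.descFactorial_eq_factorial_mul_choose (b + 1) (q + 1)
    rw [Nat.succ_descFactorial_succ] at this
    rw [mul_comm]
    exact_mod_cast this.symm
  rw [ascPochhammer_eval_neg_eq_descPochhammer, descPochhammer_eval_eq_descFactorial, h2,
    ho.neg_one_pow]
  field_simp

theorem nmbp_one_aux (b : ℕ) (z : ℚ) :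
    -(1 / ((b : ℚ) + 1)) * z ^ (b + 1) - 1 / 2 * z ^ b
      + ∑ q ∈ Finset.Icc 1 b,
        ((ascPochhammer ℚ q).eval (-(b : ℚ)) * (_root_.bernoulli (q + 1) / (q + 1).factorial))
            * z ^ (b - q) =
      -(1 / ((b : ℚ) + 1)) * (Polynomial.bernoulli (b + 1)).eval (z + 1) := by
  have h : ((b : ℚ) + 1) ≠ 0 := by positivity
  have hs : ∑ q ∈ Finset.Icc 1 b,
        ((ascPochhammer ℚ q).eval (-(b : ℚ)) * (_root_.bernoulli (q + 1) / (q + 1).factorial))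
            * z ^ (b - q) = ∑ i ∈ Finset.range b, -(1 / ((b : ℚ) + 1)) *
          (_root_.bernoulli (i + 1 + 1) * (b + 1).choose (i + 1 + 1) * z ^ (b + 1 - (i + 1 + 1))) := by
    rw [Finset.range_eq_Ico, Finset.sum_Ico_add' (fun i => -(1 / ((b : ℚ) + 1)) *
      (_root_.bernoulli (i + 1) * (b + 1).choose (i + 1) * z ^ (b + 1 - (i + 1)))) 0 b 1]
    refine Finset.sum_congr (by ext; simp) fun q hq => ?_
    rw [Finset.mem_Ico] at hq
    rw [ascPochhammer_mul_bernoulli (by omega) (by omega)]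
    simp [mul_assoc]
  rw [add_comm z 1, Polynomial.bernoulli_eval_one_add, Polynomial.bernoulli, eval_finsetSum,
    Finset.sum_range_succ', Finset.sum_range_succ', hs, ← Finset.mul_sum]
  simp only [eval_monomial]
  simp
  field_simp
  ring

/-- In depth one, `ζ(-k | z + 1) - ζ(-k | z) = -z ^ k`. -/
theorem nmbp_zero_sub (k : Fin 1 → ℕ) (z : ℚ) :
    (nmbp 0 k).eval (z + 1) - (nmbp 0 k).eval z = -z ^ k 0 := by
  have h : ((k 0 : ℚ) + 1) ≠ 0 := by positivity
  rw [nmbp, eval_mul, eval_mul, eval_C, add_comm z 1, Polynomial.bernoulli_eval_one_add]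
  simp
  field_simp
  ring

/-- The polynomials `nmbp` solve the system of difference equations
`V(-k₁, …, -k_r | z + 1) - V(-k₁, …, -k_r | z) = -z ^ k₁ * V(-k₂, …, -k_r | z + 1)`. -/
theorem nmbp_succ_sub (r : ℕ) (k : Fin (r + 2) → ℕ) (z : ℚ) :
    (nmbp (r + 1) k).eval (z + 1) - (nmbp (r + 1) k).eval z =
      -z ^ k 0 * (nmbp r (Fin.tail k)).eval (z + 1) := by
  induction r with
  | zero =>
    have key := nmbp_one_aux (k 1) z
    have hd : ∀ m, (nmbp 0 (Fin.snoc (Fin.init (Fin.init k)) m)).eval (z + 1) =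
        (nmbp 0 (Fin.snoc (Fin.init (Fin.init k)) m)).eval z - z ^ m := fun m => by
      have := nmbp_zero_sub (Fin.snoc (Fin.init (Fin.init k)) m) z
      have e : (Fin.snoc (Fin.init (Fin.init k)) m : Fin 1 → ℕ) 0 = m := by
        exact Fin.snoc_last (α := fun _ => ℕ) _ _
      rw [e] at this
      linarith
    have ht : (nmbp 0 (Fin.tail k)).eval (z + 1) =
        -(1 / ((k 1 : ℚ) + 1)) * (Polynomial.bernoulli (k 1 + 1)).eval (z + 1) := by
      rw [nmbp, eval_mul, eval_C]; rfl
    rw [ht, ← key, nmbp]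
    have e1 : Fin.last (0 + 1) = (1 : Fin 2) := rfl
    have e0 : (Fin.last 0).castSucc = (0 : Fin 2) := rfl
    simp only [e1, e0, eval_add, eval_sub, eval_mul, eval_C, eval_finsetSum, hd, mul_sub,
      Finset.sum_sub_distrib]
    have : ∀ q ∈ Finset.Icc 1 (k 1), z ^ (k 0 + k 1 - q) = z ^ k 0 * z ^ (k 1 - q) := by
      intro q hq
      rw [← pow_add, Nat.add_sub_assoc (Finset.mem_Icc.1 hq).2]
    rw [Finset.sum_congr rfl (fun q hq => congrArg (_ * ·) (this q hq))]
    simp only [mul_left_comm _ (z ^ k 0), ← Finset.mul_sum]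
    ring
  | succ r ih =>
    have hd : ∀ m, (nmbp (r + 1) (Fin.snoc (Fin.init (Fin.init k)) m)).eval (z + 1) =
        (nmbp (r + 1) (Fin.snoc (Fin.init (Fin.init k)) m)).eval z - z ^ k 0 *
          (nmbp r (Fin.snoc (Fin.init (Fin.init (Fin.tail k))) m)).eval (z + 1) := fun m => by
      have := ih (Fin.snoc (Fin.init (Fin.init k)) m)
      have e : (Fin.snoc (Fin.init (Fin.init k)) m : Fin (r + 2) → ℕ) 0 = k 0 := by
        exact Fin.snoc_castSucc (α := fun _ => ℕ) _ _ (0 : Fin (r + 1))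
      have e' : Fin.tail (Fin.snoc (Fin.init (Fin.init k)) m : Fin (r + 2) → ℕ) =
          Fin.snoc (Fin.init (Fin.init (Fin.tail k))) m := by
        funext i
        refine Fin.lastCases ?_ (fun j => ?_) i
        · rw [Fin.snoc_last (α := fun _ => ℕ)]
          exact Fin.snoc_last (α := fun _ => ℕ) _ _
        · rw [Fin.snoc_castSucc (α := fun _ => ℕ)]
          exact Fin.snoc_castSucc (α := fun _ => ℕ) _ _ j.succ
      rw [e, e'] at this
      linarith
    rw [nmbp.eq_2 (r + 1) k, nmbp.eq_2 r (Fin.tail k)]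
    have e1 : Fin.tail k (Fin.last (r + 1)) = k (Fin.last (r + 1 + 1)) := rfl
    have e0 : Fin.tail k (Fin.last r).castSucc = k (Fin.last (r + 1)).castSucc := rfl
    simp only [e1, e0, eval_add, eval_sub, eval_mul, eval_C, eval_finsetSum, hd, mul_sub,
      Finset.sum_sub_distrib, mul_add, Finset.mul_sum]
    simp only [mul_left_comm _ (z ^ k 0), ← Finset.mul_sum]
    ring

/-- Near `x`, the function `Z` on `ℂ^r` is the quotient `p / q` of two holomorphic functions,
wherever the denominator (which does not vanish identically near `x`) is nonzero. -/
def IsQuotientAt {r : ℕ} (Z p q : (Fin r → ℂ) → ℂ) (x : Fin r → ℂ) : Prop :=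
  AnalyticAt ℂ p x ∧ AnalyticAt ℂ q x ∧ ¬ (∀ᶠ y in 𝓝 x, q y = 0) ∧
    ∀ᶠ y in 𝓝 x, q y ≠ 0 → Z y = p y / q y

/-- `Z` is a meromorphic function on `ℂ^r`: it is locally a quotient of holomorphic functions, and
wherever the quotient extends holomorphically, `Z` takes the values of that extension.  (Hence `Z`
is holomorphic off the polar set; its values at points of the polar set are irrelevant.) -/
structure IsMeromorphic {r : ℕ} (Z : (Fin r → ℂ) → ℂ) : Prop where
  exists_quotient : ∀ x, ∃ p q, IsQuotientAt Z p q x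
  eq_of_extends : ∀ x p q, IsQuotientAt Z p q x →
    ∀ g, AnalyticAt ℂ g x → (∀ᶠ y in 𝓝 x, p y = g y * q y) → ∀ᶠ y in 𝓝 x, Z y = g y

/-- The region `Re (s_j + ⋯ + s_r) > r - j + 1` for `j = 1, …, r` (here `j` starts from `0`). -/
def convergenceRegion (r : ℕ) : Set (Fin r → ℂ) :=
  {s | ∀ j : Fin r, (r : ℝ) - (j : ℕ) < (∑ i ∈ Finset.Ici j, s i).re}

/-- `Z` is the meromorphic continuation to `ℂ^r` of the multiple zeta function
`∑_{0 < n₁ < ⋯ < n_r} 1 / (n₁ ^ s₁ ⋯ n_r ^ s_r)`. -/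
structure IsMultipleZeta {r : ℕ} (Z : (Fin r → ℂ) → ℂ) : Prop where
  meromorphic : IsMeromorphic Z
  hasSum : ∀ s ∈ convergenceRegion r,
    HasSum (fun n : {n : Fin r → ℕ // StrictMono n ∧ ∀ i, 0 < n i} =>
      1 / ∏ i, (n.1 i : ℂ) ^ s i) (Z s)

/-- The iterated limit `lim_{s₁ → a₁} ⋯ lim_{s_r → a_r} f (s₁, …, s_r)` exists and equals `L`.
The innermost limit is the one in the last variable; each limit is taken over a punctured
neighbourhood, and the inner iterated limit has to exist for all `s₁ ≠ a₁` near `a₁`. -/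
def HasIteratedLimit : (r : ℕ) → ((Fin r → ℂ) → ℂ) → (Fin r → ℂ) → ℂ → Prop
  | 0, f, a, L => f a = L
  | r + 1, f, a, L => ∃ g : ℂ → ℂ,
      (∀ᶠ s in 𝓝[≠] (a 0), HasIteratedLimit r (fun t => f (Fin.cons s t)) (Fin.tail a) (g s)) ∧
      Tendsto g (𝓝[≠] (a 0)) (𝓝 L)

end PolyZeta

/-! Apply Euler–Maclaurin to the innermost sum over `n_r > n_{r-1}`. Multiplied by `s_r - 1`, this
tail has the asymptotic expansion `∑ B_i/i! (s_r - 1)_i n_{r-1}^{-(s_r - 1 + i)}`. Hence `(s_r - 1)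
ζ(s_1, …, s_r)` equals the sum over `i < I` of `B_i/i! (s_r - 1)_i ζ(s_1, …, s_{r-2}, s_{r-1} + s_r
- 1 + i)` plus a remainder series (`remainder_succ`), holomorphic on a region that exhausts the
whole space as `I` grows (`analyticAt_remainder`). Induction on the depth gives the continuation
`mz`, whose poles can lie only on `s_r = 1` and on hyperplanes `s_j + ⋯ + s_r ∈ ℤ` with `j < r`.

At `s_r = -b` the expansion terminates and is exact: the factors `(-b - 1)_i` vanish for `i ≥ b +
2`, and the remainder vanishes by the difference equation of the Bernoulli polynomials
(`emTerm_neg_natCast`). What is left is the recursion defining `nmbp` (`mz_snoc_neg_natCast`,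
`nmbp_succ_eval_one`). For generic outer variables the point with `s_r = -b` is regular, so the
innermost limit is the value there, a combination of translates of the function of depth one less;
induction computes the other limits. The recursion does not involve `z`; the value `z = 1` enters
only through `ζ(-k) = -B_{k+1}(1)/(k+1)` in depth one.

The limit is claimed for every continuation, so each one must be identified with `mz` at regular
points. This is an identity theorem for local quotients, `IsMeromorphic.eventuallyEq_of_analyticAt`.
-/

namespace PolyZeta

/-! ### Germs of holomorphic functions -/

section Germs

variable {E : Type*} [NormedAddCommGroup E] [NormedSpace ℂ E]

theorem exists_ball_analyticOnNhd {f : E → ℂ} {x : E} (hf : AnalyticAt ℂ f x) {P : E → Prop}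
    (hP : ∀ᶠ y in 𝓝 x, P y) :
    ∃ ε > 0, AnalyticOnNhd ℂ f (Metric.ball x ε) ∧ ∀ y ∈ Metric.ball x ε, P y := by
  obtain ⟨ε, hε, h⟩ := Metric.eventually_nhds_iff_ball.1 (hf.eventually_analyticAt.and hP)
  exact ⟨ε, hε, fun y hy => (h y hy).1, fun y hy => (h y hy).2⟩

/-- Germs of holomorphic functions form an integral domain: near a point where `f` is nonzero the
factor `g` vanishes on an open set, and the identity theorem on a ball carries this back to `x`. -/
theorem eventually_eq_zero_or_of_mul {f g : E → ℂ} {x : E} (hf : AnalyticAt ℂ f x)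
    (hg : AnalyticAt ℂ g x) (h : ∀ᶠ y in 𝓝 x, f y * g y = 0) :
    (∀ᶠ y in 𝓝 x, f y = 0) ∨ ∀ᶠ y in 𝓝 x, g y = 0 := by
  obtain ⟨ε, hε, hgB, hB⟩ := exists_ball_analyticOnNhd hg (hf.eventually_analyticAt.and h)
  by_contra! hc
  obtain ⟨h1, h2⟩ := hc
  obtain ⟨y, hy, hyB⟩ := (h1.and_eventually (Metric.ball_mem_nhds x hε)).exists
  have hfy : ∀ᶠ z in 𝓝 y, f z ≠ 0 := (hB y hyB).1.continuousAt.eventually_ne hy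
  have hgy : g =ᶠ[𝓝 y] 0 := by
    filter_upwards [hfy, Metric.isOpen_ball.mem_nhds hyB] with z hz hzB
    exact (mul_eq_zero.1 (hB z hzB).2).resolve_left hz
  have := hgB.eqOn_zero_of_preconnected_of_eventuallyEq_zero
    (convex_ball x ε).isPreconnected hyB hgy
  exact h2 (Filter.mem_of_superset (Metric.ball_mem_nhds x hε) fun z hz => not_not.2 (this hz))

theorem eventually_not_eventually_eq_zero {q : E → ℂ} {x : E} (hq : AnalyticAt ℂ q x)
    (h : ¬ ∀ᶠ y in 𝓝 x, q y = 0) : ∀ᶠ y in 𝓝 x, ¬ ∀ᶠ z in 𝓝 y, q z = 0 := by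
  obtain ⟨ε, hε, hB, -⟩ := exists_ball_analyticOnNhd (P := fun _ => True) hq (by simp)
  filter_upwards [Metric.ball_mem_nhds x hε] with y hy hy0
  have := hB.eqOn_zero_of_preconnected_of_eventuallyEq_zero
    (convex_ball x ε).isPreconnected hy hy0
  exact h (Filter.mem_of_superset (Metric.ball_mem_nhds x hε) this)

end Germs

/-! ### Local quotients and the identity theorem for them -/

section Meromorphic

variable {r : ℕ} {Z Z' p q p' q' g g' : (Fin r → ℂ) → ℂ} {x : Fin r → ℂ}

theorem IsQuotientAt.eventually (h : IsQuotientAt Z p q x) :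
    ∀ᶠ y in 𝓝 x, IsQuotientAt Z p q y := by
  filter_upwards [h.1.eventually_analyticAt, h.2.1.eventually_analyticAt,
    eventually_not_eventually_eq_zero h.2.1 h.2.2.1, h.2.2.2.eventually_nhds] with y h1 h2 h3 h4
  exact ⟨h1, h2, h3, h4⟩

theorem IsQuotientAt.cross_mul (h : IsQuotientAt Z p q x) (h' : IsQuotientAt Z' p' q' x)
    (hZ : Z =ᶠ[𝓝 x] Z') : ∀ᶠ y in 𝓝 x, p y * q' y - p' y * q y = 0 := by
  obtain ⟨hp, hq, hq0, hZp⟩ := h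
  obtain ⟨hp', hq', hq0', hZp'⟩ := h'
  have key : ∀ᶠ y in 𝓝 x, q y * (q' y * (p y * q' y - p' y * q y)) = 0 := by
    filter_upwards [hZp, hZp', hZ] with y h1 h2 h3
    by_cases hy : q y = 0
    · simp [hy]
    by_cases hy' : q' y = 0
    · simp [hy']
    have := (h1 hy).symm.trans (h3.trans (h2 hy'))
    rw [div_eq_div_iff hy hy'] at this
    simp [this]
  have hd : AnalyticAt ℂ (fun y => p y * q' y - p' y * q y) x := (hp.mul hq').sub (hp'.mul hq)
  have h1 := (eventually_eq_zero_or_of_mul hq (hq'.mul hd) key).resolve_left hq0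
  exact (eventually_eq_zero_or_of_mul hq' hd h1).resolve_left hq0'

/-- The quotient of holomorphic functions which `Z` is near `x` extends to the holomorphic
function `g`. -/
def HasExtension (Z : (Fin r → ℂ) → ℂ) (x : Fin r → ℂ) (g : (Fin r → ℂ) → ℂ) : Prop :=
  ∃ p q, IsQuotientAt Z p q x ∧ AnalyticAt ℂ g x ∧ ∀ᶠ y in 𝓝 x, p y = g y * q y

theorem HasExtension.eventually (h : HasExtension Z x g) :
    ∀ᶠ y in 𝓝 x, HasExtension Z y g := by
  obtain ⟨p, q, h, hg, hpq⟩ := h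
  filter_upwards [h.eventually, hg.eventually_analyticAt, hpq.eventually_nhds] with y h1 h2 h3
  exact ⟨p, q, h1, h2, h3⟩

theorem HasExtension.eventuallyEq (h : HasExtension Z x g) (h' : HasExtension Z x g') :
    g =ᶠ[𝓝 x] g' := by
  obtain ⟨p, q, h, hg, hpq⟩ := h
  obtain ⟨p', q', h', hg', hpq'⟩ := h'
  have key : ∀ᶠ y in 𝓝 x, q y * (q' y * (g y - g' y)) = 0 := by
    filter_upwards [h.cross_mul h' .rfl, hpq, hpq'] with y h1 h2 h3
    rw [h2, h3] at h1
    linear_combination h1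
  have h1 := (eventually_eq_zero_or_of_mul h.2.1 (h'.2.1.mul (hg.sub hg')) key).resolve_left h.2.2.1
  have h2 := (eventually_eq_zero_or_of_mul h'.2.1 (hg.sub hg') h1).resolve_left h'.2.2.1
  exact h2.mono fun y hy => sub_eq_zero.1 hy

theorem AnalyticAt.isQuotientAt (h : AnalyticAt ℂ Z x) : IsQuotientAt Z Z 1 x :=
  ⟨h, analyticAt_const, by simp [NeBot.ne], by simp⟩

theorem AnalyticAt.hasExtension (h : AnalyticAt ℂ Z x) : HasExtension Z x Z :=
  ⟨Z, 1, AnalyticAt.isQuotientAt h, h, by simp⟩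

theorem IsQuotientAt.hasExtension (h : IsQuotientAt Z p q x) (hq : q x ≠ 0) :
    HasExtension Z x (fun y => p y / q y) := by
  refine ⟨p, q, h, h.1.div h.2.1 hq, ?_⟩
  filter_upwards [h.2.1.continuousAt.eventually_ne hq] with y hy
  field_simp

open Classical in
/-- `Z`, with its values changed to those of the holomorphic extension, where there is one. -/
noncomputable def normalize (Z : (Fin r → ℂ) → ℂ) (x : Fin r → ℂ) : ℂ :=
  if h : ∃ g, HasExtension Z x g then h.choose x else Z x

theorem normalize_apply (h : HasExtension Z x g) : normalize Z x = g x := by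
  have h' : ∃ g, HasExtension Z x g := ⟨g, h⟩
  rw [normalize, dif_pos h']
  exact (h'.choose_spec.eventuallyEq h).self_of_nhds

theorem normalize_eventuallyEq (h : HasExtension Z x g) : normalize Z =ᶠ[𝓝 x] g :=
  h.eventually.mono fun _ hy => normalize_apply hy

theorem IsQuotientAt.normalize (h : IsQuotientAt Z p q x) :
    IsQuotientAt (normalize Z) p q x :=
  ⟨h.1, h.2.1, h.2.2.1, h.eventually.mono fun _ hy hq => normalize_apply (hy.hasExtension hq)⟩

theorem isMeromorphic_normalize (h : ∀ x, ∃ p q, IsQuotientAt Z p q x) :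
    IsMeromorphic (normalize Z) where
  exists_quotient x := by
    obtain ⟨p, q, h⟩ := h x
    exact ⟨p, q, h.normalize⟩
  eq_of_extends x p q hpq g hg hp := by
    obtain ⟨p', q', h'⟩ := h x
    refine normalize_eventuallyEq ⟨p', q', h', hg, ?_⟩
    have key : ∀ᶠ y in 𝓝 x, q y * (p' y - g y * q' y) = 0 := by
      filter_upwards [hpq.cross_mul h'.normalize .rfl, hp] with y h1 h2
      rw [h2] at h1
      linear_combination -h1
    have := (eventually_eq_zero_or_of_mul hpq.2.1 (h'.1.sub (hg.mul h'.2.1)) key).resolve_left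
      hpq.2.2.1
    exact this.mono fun y hy => sub_eq_zero.1 hy

/-- The relation `p q' = p' q` spreads from any point of agreement over a ball, and by connectedness
over the whole space. Where `Z'` is holomorphic it reads `p = Z' q`, so `Z'` is the extension whose
values `Z` must take. -/
theorem IsMeromorphic.eventuallyEq_of_analyticAt (hZ : IsMeromorphic Z)
    (hZ' : ∀ x, ∃ p q, IsQuotientAt Z' p q x) {x₀ : Fin r → ℂ} (h₀ : Z =ᶠ[𝓝 x₀] Z')
    (hx : AnalyticAt ℂ Z' x) : Z =ᶠ[𝓝 x] Z' := by
  set W : Set (Fin r → ℂ) := {y | Z =ᶠ[𝓝 y] Z'} with hW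
  have hopen : ∀ y ∈ closure W, ∀ p q p' q', IsQuotientAt Z p q y → IsQuotientAt Z' p' q' y →
      ∀ᶠ z in 𝓝 y, p z * q' z - p' z * q z = 0 := by
    intro y hy p q p' q' h h'
    have hd : AnalyticAt ℂ (fun y => p y * q' y - p' y * q y) y :=
      (h.1.mul h'.2.1).sub (h'.1.mul h.2.1)
    obtain ⟨ε, hε, hB, hQ⟩ := exists_ball_analyticOnNhd hd (h.eventually.and h'.eventually)
    obtain ⟨z, hzW, hz⟩ := Metric.mem_closure_iff.1 hy ε hε
    have hzB : z ∈ Metric.ball y ε := by rwa [Metric.mem_ball, dist_comm]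
    have hz0 := (hQ z hzB).1.cross_mul (hQ z hzB).2 hzW
    have := hB.eqOn_zero_of_preconnected_of_eventuallyEq_zero
      (convex_ball y ε).isPreconnected hzB hz0
    exact Filter.mem_of_superset (Metric.ball_mem_nhds y hε) this
  -- The closure is used because `Z'` is unconstrained on the zero set of its denominator; agreement
  -- can be expected only on a dense set.
  have hclopen : IsClopen (closure W) := by
    refine ⟨isClosed_closure, isOpen_iff_mem_nhds.2 fun y hy => ?_⟩
    obtain ⟨p, q, h⟩ := hZ.exists_quotient y
    obtain ⟨p', q', h'⟩ := hZ' y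
    have hqq : ¬ ∀ᶠ z in 𝓝 y, q z * q' z = 0 := fun h0 =>
      (eventually_eq_zero_or_of_mul h.2.1 h'.2.1 h0).elim h.2.2.1 h'.2.2.1
    have hev := (((hopen y hy p q p' q' h h').and (h.2.2.2.and h'.2.2.2)).eventually_nhds).and
      ((eventually_not_eventually_eq_zero (h.2.1.mul h'.2.1) hqq).and
        (h.2.1.eventually_analyticAt.and h'.2.1.eventually_analyticAt))
    filter_upwards [hev.eventually_nhds] with z hz
    rw [mem_closure_iff_nhds]
    intro U hU
    -- A point with `q w * q' w ≠ 0` exists arbitrarily close to `z`; around it both quotients are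
    -- genuine and equal, so it lies in `W`.
    obtain ⟨w, hw, hwU, hwz⟩ := (not_eventually.1 hz.self_of_nhds.2.1).and_eventually
      ((eventually_mem_nhds_iff.2 hU).and hz) |>.exists
    refine ⟨w, mem_of_mem_nhds hwU, ?_⟩
    have hne := (hwz.2.2.1.mul hwz.2.2.2).continuousAt.eventually_ne hw
    filter_upwards [hwz.1, hne] with v hv hv0
    rw [hv.2.1 (left_ne_zero_of_mul hv0), hv.2.2 (right_ne_zero_of_mul hv0),
      div_eq_div_iff (left_ne_zero_of_mul hv0) (right_ne_zero_of_mul hv0)]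
    exact sub_eq_zero.1 hv.1
  have huniv : closure W = Set.univ := hclopen.eq_univ ⟨x₀, subset_closure h₀⟩
  obtain ⟨p, q, h⟩ := hZ.exists_quotient x
  refine hZ.eq_of_extends x p q h Z' hx ?_
  filter_upwards [hopen x (huniv ▸ Set.mem_univ x) p q Z' 1 h (AnalyticAt.isQuotientAt hx)] with y hy
  simpa [sub_eq_zero] using hy

theorem IsQuotientAt.congr (h : IsQuotientAt Z p q x) (hZ : Z =ᶠ[𝓝 x] Z') :
    IsQuotientAt Z' p q x :=
  ⟨h.1, h.2.1, h.2.2.1, by filter_upwards [h.2.2.2, hZ] with y h1 h2 hq; rw [← h2, h1 hq]⟩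

theorem IsQuotientAt.add (h : IsQuotientAt Z p q x) (h' : IsQuotientAt Z' p' q' x) :
    IsQuotientAt (fun y => Z y + Z' y) (fun y => p y * q' y + q y * p' y)
      (fun y => q y * q' y) x := by
  refine ⟨(h.1.mul h'.2.1).add (h.2.1.mul h'.1), h.2.1.mul h'.2.1, fun h0 =>
      (eventually_eq_zero_or_of_mul h.2.1 h'.2.1 h0).elim h.2.2.1 h'.2.2.1, ?_⟩
  filter_upwards [h.2.2.2, h'.2.2.2] with y h1 h2 hq
  rw [h1 (left_ne_zero_of_mul hq), h2 (right_ne_zero_of_mul hq),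
    div_add_div _ _ (left_ne_zero_of_mul hq) (right_ne_zero_of_mul hq)]

theorem IsQuotientAt.mul (h : IsQuotientAt Z p q x) (h' : IsQuotientAt Z' p' q' x) :
    IsQuotientAt (fun y => Z y * Z' y) (fun y => p y * p' y) (fun y => q y * q' y) x := by
  refine ⟨h.1.mul h'.1, h.2.1.mul h'.2.1, fun h0 =>
      (eventually_eq_zero_or_of_mul h.2.1 h'.2.1 h0).elim h.2.2.1 h'.2.2.1, ?_⟩
  filter_upwards [h.2.2.2, h'.2.2.2] with y h1 h2 hq
  rw [h1 (left_ne_zero_of_mul hq), h2 (right_ne_zero_of_mul hq), div_mul_div_comm]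

theorem exists_isQuotientAt_sum {ι : Type*} (t : Finset ι) {F : ι → (Fin r → ℂ) → ℂ}
    (h : ∀ i ∈ t, ∃ p q, IsQuotientAt (F i) p q x) :
    ∃ p q, IsQuotientAt (fun y => ∑ i ∈ t, F i y) p q x := by
  classical
  induction t using Finset.induction_on with
  | empty =>
    exact ⟨_, _, (AnalyticAt.isQuotientAt (Z := fun _ : Fin r → ℂ => (0 : ℂ)) analyticAt_const).congr
      (by simp)⟩
  | insert a t ha ih =>
    obtain ⟨p, q, h1⟩ := ih fun i hi => h i (Finset.mem_insert_of_mem hi)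
    obtain ⟨p', q', h2⟩ := h a (Finset.mem_insert_self a t)
    exact ⟨_, _, (h2.add h1).congr (by simp [Finset.sum_insert ha])⟩

/-- Openness of `φ` keeps the pulled-back denominator from vanishing identically. -/
theorem IsQuotientAt.comp {m : ℕ} {φ : (Fin m → ℂ) → Fin r → ℂ} {y : Fin m → ℂ}
    (h : IsQuotientAt Z p q (φ y)) (hφ : AnalyticAt ℂ φ y) (hopen : IsOpenMap φ) :
    IsQuotientAt (Z ∘ φ) (p ∘ φ) (q ∘ φ) y := by
  refine ⟨h.1.comp hφ, h.2.1.comp hφ, fun h0 => h.2.2.1 ?_,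
    hφ.continuousAt.eventually h.2.2.2⟩
  have := hopen.image_mem_nhds h0
  filter_upwards [this] with z hz
  obtain ⟨w, hw, rfl⟩ := hz
  exact hw

end Meromorphic

/-! ### Convergence, holomorphy and telescoping of multiple series -/

section MultipleSums

/-- The index set `0 < n₁ < ⋯ < n_r` of a multiple zeta series. -/
abbrev Tuple (r : ℕ) := {n : Fin r → ℕ // StrictMono n ∧ ∀ i, 0 < n i}

/-- The sum of `a₁(n₁) ⋯ a_r(n_r)` over `0 < n₁ < ⋯ < n_r`. -/
noncomputable def multiSum {r : ℕ} (a : Fin r → ℕ → ℂ) : ℂ := ∑' n : Tuple r, ∏ i, a i (n.1 i)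

/-- The real exponents for which the multiple zeta series converges. -/
def tailRegion {r : ℕ} (c : Fin r → ℝ) : Prop :=
  ∀ j : Fin r, (r : ℝ) - (j : ℕ) < ∑ i ∈ Finset.Ici j, c i

variable {r : ℕ}

theorem mem_convergenceRegion {s : Fin r → ℂ} :
    s ∈ convergenceRegion r ↔ tailRegion fun i => (s i).re := by
  simp [convergenceRegion, tailRegion]

theorem sum_Ici_succ {M : Type*} [AddCommMonoid M] (f : Fin (r + 1) → M) (j : Fin r) :
    ∑ i ∈ Finset.Ici j.succ, f i = ∑ i ∈ Finset.Ici j, f i.succ := by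
  rw [← Fin.map_succEmb_Ici, Finset.sum_map]
  rfl

/-- Abel summation: the sum is a combination of the tail sums of `e`, with coefficients `L 0` and
the increments of `L`. -/
theorem sum_mul_nonneg_of_monotone (e L : Fin r → ℝ) (he : ∀ j, 0 ≤ ∑ i ∈ Finset.Ici j, e i)
    (hL : Monotone L) (hL0 : ∀ i, 0 ≤ L i) : 0 ≤ ∑ i, e i * L i := by
  induction r with
  | zero => simp
  | succ r ih =>
    have h1 := ih (fun i => e i.succ) (fun i => L i.succ - L 0)
      (fun j => by rw [← sum_Ici_succ]; exact he _)
      (fun i j hij => by simpa using hL (Fin.succ_le_succ_iff.2 hij))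
      (fun i => by simpa using hL (Fin.zero_le i.succ))
    have h2 : 0 ≤ (∑ i, e i) * L 0 := by
      refine mul_nonneg ?_ (hL0 0)
      have := he 0
      rwa [show Finset.Ici (0 : Fin (r + 1)) = Finset.univ by ext; simp] at this
    rw [Fin.sum_univ_succ] at h2 ⊢
    simp only [mul_sub, Finset.sum_sub_distrib, ← Finset.sum_mul] at h1
    linarith

theorem tailRegion.exists_sub {c : Fin r → ℝ} (hc : tailRegion c) :
    ∃ η > 0, tailRegion fun i => c i - η := by
  have h : ∀ᶠ η : ℝ in 𝓝[>] 0, ∀ j : Fin r, (r : ℝ) - (j : ℕ) < ∑ i ∈ Finset.Ici j, (c i - η) := by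
    refine eventually_all.2 fun j => ?_
    refine eventually_nhdsWithin_of_eventually_nhds ?_
    have : ContinuousAt (fun η : ℝ => ∑ i ∈ Finset.Ici j, (c i - η)) 0 := by fun_prop
    exact this.eventually (eventually_gt_nhds (by simpa using hc j))
  obtain ⟨η, h1, h2⟩ := (h.and self_mem_nhdsWithin).exists
  exact ⟨η, h2, h1⟩

theorem summable_pi_prod {f : ℕ → ℝ} (hf : Summable f) (h0 : ∀ n, 0 ≤ f n) :
    Summable fun n : Fin r → ℕ => ∏ i, f (n i) := by
  induction r with
  | zero => exact (hasSum_fintype _).summable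
  | succ r ih =>
    rw [← (Fin.consEquiv fun _ => ℕ).summable_iff]
    refine (hf.mul_of_nonneg ih h0 fun n => Finset.prod_nonneg fun i _ => h0 _).congr fun n => ?_
    simp [Fin.prod_univ_succ, Fin.consEquiv]

theorem Tuple.one_le (n : Tuple r) (i : Fin r) : (1 : ℝ) ≤ n.1 i := by
  exact_mod_cast n.2.2 i

/-- Abel summation with `L i = log n_i` bounds the term by `∏ n_i ^ (-(1 + η))`, a product of
convergent one-variable series; monotonicity of the tuple is what makes conditions on tail sums
sufficient. -/
theorem summable_prod_rpow {c : Fin r → ℝ} (hc : tailRegion c) :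
    Summable fun n : Tuple r => ∏ i, (n.1 i : ℝ) ^ (-c i) := by
  obtain ⟨η, hη, hc'⟩ := hc.exists_sub
  have hs : Summable fun n : Tuple r => ∏ i, (n.1 i : ℝ) ^ (-(1 + η)) :=
    (summable_pi_prod (r := r) (Real.summable_nat_rpow.2 (by linarith : -(1 + η) < -1))
      (fun n => by positivity)).subtype _
  refine hs.of_nonneg_of_le (fun n => Finset.prod_nonneg fun i _ => by positivity) fun n => ?_
  have hpos : ∀ i, (0 : ℝ) < n.1 i := fun i => one_pos.trans_le (n.one_le i)
  have key := sum_mul_nonneg_of_monotone (fun i => c i - (1 + η)) (fun i => Real.log (n.1 i))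
    (fun j => by
      have := hc' j
      simp only [Finset.sum_sub_distrib, Finset.sum_const, Fin.card_Ici, nsmul_eq_mul] at this ⊢
      rw [Nat.cast_sub j.2.le] at this ⊢
      linarith)
    (fun i j hij => Real.log_le_log (hpos i) (by exact_mod_cast n.2.1.monotone hij))
    (fun i => Real.log_nonneg (n.one_le i))
  simp only [Real.rpow_def_of_pos (hpos _), ← Real.exp_sum]
  refine Real.exp_le_exp.2 ?_
  simp only [sub_mul, Finset.sum_sub_distrib] at key
  simp only [mul_neg, Finset.sum_neg_distrib]
  simp only [mul_comm (Real.log _)]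
  linarith

theorem summable_multiSum {a : Fin r → ℕ → ℂ} {c : Fin r → ℝ} (hc : tailRegion c)
    (h : ∀ i, ∃ C, ∀ n : ℕ, 1 ≤ n → ‖a i n‖ ≤ C * (n : ℝ) ^ (-c i)) :
    Summable fun n : Tuple r => ∏ i, a i (n.1 i) := by
  choose C hC using h
  refine ((summable_prod_rpow hc).mul_left (∏ i, C i)).of_norm_bounded fun n => ?_
  rw [norm_prod, ← Finset.prod_mul_distrib]
  exact Finset.prod_le_prod (fun i _ => norm_nonneg _) fun i _ => hC i _ (n.2.2 i)

open BoundedContinuousFunction in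
-- The sequence is packaged as one holomorphic map into the Banach space of bounded sequences. Since
-- `δ` tends to zero, its finite truncations converge uniformly.
theorem exists_analyticAt_boundedFunction {f : ℕ → ℂ → ℂ} (hd : ∀ n, Differentiable ℂ (f n))
    {δ : ℕ → ℝ} (hδ : Tendsto δ atTop (𝓝 0)) {s₀ : ℂ}
    (hb : ∀ᶠ s in 𝓝 s₀, ∀ n, ‖f n s‖ ≤ δ n) :
    ∃ u : ℂ → (ℕ →ᵇ ℂ), AnalyticAt ℂ u s₀ ∧ ∀ᶠ s in 𝓝 s₀, ∀ n, u s n = f n s := by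
  obtain ⟨ε, hε, hball⟩ := Metric.eventually_nhds_iff_ball.1 hb
  obtain ⟨C, hC⟩ := hδ.bddAbove_range
  have hbound : ∀ s ∈ Metric.ball s₀ ε, ∀ n, ‖f n s‖ ≤ C := fun s hs n =>
    (hball s hs n).trans (hC ⟨n, rfl⟩)
  classical
  let u : ℂ → (ℕ →ᵇ ℂ) := fun s => if h : s ∈ Metric.ball s₀ ε then
    BoundedContinuousFunction.ofNormedAddCommGroupDiscrete (fun n => f n s) C (hbound s h) else 0
  have hu : ∀ s ∈ Metric.ball s₀ ε, ∀ n, u s n = f n s := fun s hs n => by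
    simp only [u, dif_pos hs]; rfl
  let e : ℕ → (ℕ →ᵇ ℂ) := fun n => BoundedContinuousFunction.ofNormedAddCommGroupDiscrete
    (fun m => if m = n then 1 else 0) 1 (fun m => by split_ifs <;> simp)
  let F : ℕ → ℂ → (ℕ →ᵇ ℂ) := fun N s => ∑ n ∈ Finset.range N, f n s • e n
  have hF : ∀ N s m, F N s m = if m < N then f m s else 0 := by
    intro N s m
    simp [F, e, BoundedContinuousFunction.sum_apply]
  have hlim : TendstoUniformlyOn F u atTop (Metric.ball s₀ ε) := by
    rw [Metric.tendstoUniformlyOn_iff]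
    intro η hη
    obtain ⟨N₀, hN₀⟩ := eventually_atTop.1 (hδ.eventually (gt_mem_nhds (half_pos hη)))
    filter_upwards [eventually_ge_atTop N₀] with N hN s hs
    refine lt_of_le_of_lt ((BoundedContinuousFunction.dist_le (half_pos hη).le).2 fun m => ?_)
      (half_lt_self hη)
    rw [hu s hs, hF]
    split_ifs with h
    · simpa using (half_pos hη).le
    · rw [dist_zero_right]
      exact (hball s hs m).trans (hN₀ m (by omega)).le
  have hdiff : DifferentiableOn ℂ u (Metric.ball s₀ ε) :=
    hlim.tendstoLocallyUniformlyOn.differentiableOn (Eventually.of_forall fun N =>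
      (Differentiable.fun_sum fun n _ => (hd n).smul_const (e n)).differentiableOn)
      Metric.isOpen_ball
  refine ⟨u, hdiff.analyticAt (Metric.ball_mem_nhds _ hε), ?_⟩
  filter_upwards [Metric.ball_mem_nhds s₀ hε] with s hs
  exact hu s hs

open BoundedContinuousFunction in
-- Joint holomorphy comes from factoring the series through one continuous multilinear map on
-- bounded sequences, `v ↦ ∑ w(n) ∏ v_i(n_i)` with summable weights, evaluated at sequences
-- depending holomorphically on each `s_i`.
theorem analyticAt_multiSum {a : Fin r → ℕ → ℂ → ℂ} (hd : ∀ i n, 1 ≤ n → Differentiable ℂ (a i n))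
    {c : Fin r → ℝ} (hc : tailRegion c) {s₀ : Fin r → ℂ}
    (hb : ∀ i, ∃ C, ∀ᶠ s in 𝓝 (s₀ i), ∀ n : ℕ, 1 ≤ n → ‖a i n s‖ ≤ C * (n : ℝ) ^ (-c i)) :
    AnalyticAt ℂ (fun s : Fin r → ℂ => multiSum fun i n => a i n (s i)) s₀ := by
  obtain ⟨η, hη, hc'⟩ := hc.exists_sub
  choose C hC using hb
  -- The weight leaves each factor of size `n ^ (-η)`, which tends to zero, while the compensating
  -- weights `w` are still summable. The index `0`, about which nothing is assumed, is set to zero.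
  set f : Fin r → ℕ → ℂ → ℂ := fun i n s =>
    if n = 0 then 0 else (((n : ℝ) ^ (c i - η) : ℝ) : ℂ) * a i n s with hf
  have hfb : ∀ i, ∀ᶠ s in 𝓝 (s₀ i), ∀ n, ‖f i n s‖ ≤ C i * (n : ℝ) ^ (-η) := fun i => by
    filter_upwards [hC i] with s hs n
    rcases Nat.eq_zero_or_pos n with rfl | hn
    · simp [hf, Real.zero_rpow (neg_ne_zero.2 hη.ne')]
    have hn' : (0 : ℝ) < n := by exact_mod_cast hn
    simp only [hf, hn.ne', if_false, norm_mul, Complex.norm_real, Real.norm_eq_abs,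
      abs_of_pos (Real.rpow_pos_of_pos hn' _)]
    calc _ ≤ (n : ℝ) ^ (c i - η) * (C i * (n : ℝ) ^ (-c i)) := by gcongr; exact hs n hn
      _ = _ := by
        rw [mul_left_comm, ← Real.rpow_add hn']; ring_nf
  have hδ : ∀ i, Tendsto (fun n : ℕ => C i * (n : ℝ) ^ (-η)) atTop (𝓝 0) := fun i => by
    simpa using ((tendsto_rpow_neg_atTop hη).comp tendsto_natCast_atTop_atTop).const_mul (C i)
  have hfd : ∀ i n, Differentiable ℂ (f i n) := fun i n => by
    by_cases hn : n = 0
    · simp [hf, hn]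
    · simp only [hf, hn, if_false]
      exact (hd i n (Nat.pos_of_ne_zero hn)).const_mul _
  choose u hu huf using fun i => exists_analyticAt_boundedFunction (hfd i) (hδ i) (hfb i)
  let M : Tuple r → ContinuousMultilinearMap ℂ (fun _ : Fin r => (ℕ →ᵇ ℂ)) ℂ := fun n =>
    (ContinuousMultilinearMap.mkPiAlgebra ℂ (Fin r) ℂ).compContinuousLinearMap
      fun i => BoundedContinuousFunction.evalCLM ℂ (n.1 i)
  let w : Tuple r → ℝ := fun n => ∏ i, (n.1 i : ℝ) ^ (-(c i - η))
  have hw : ∀ n, 0 ≤ w n := fun n => Finset.prod_nonneg fun i _ => by positivity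
  have hM : ∀ n v, M n v = ∏ i, v i (n.1 i) := fun n v => by
    simp [M]
  have hMn : ∀ n, ‖M n‖ ≤ 1 := fun n =>
    ContinuousMultilinearMap.opNorm_le_bound zero_le_one fun v => by
      rw [hM, norm_prod, one_mul]
      exact Finset.prod_le_prod (fun i _ => norm_nonneg _) fun i _ => (v i).norm_coe_le_norm _
  have hsum : Summable fun n => ((w n : ℝ) : ℂ) • M n := by
    refine (summable_prod_rpow hc').of_norm_bounded fun n => ?_
    rw [norm_smul, Complex.norm_real, Real.norm_of_nonneg (hw n)]
    exact mul_le_of_le_one_right (hw n) (hMn n)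
  have han : AnalyticAt ℂ (fun s : Fin r → ℂ => (∑' n, ((w n : ℝ) : ℂ) • M n) fun i => u i (s i))
      s₀ := by
    have h1 : AnalyticAt ℂ (fun s : Fin r → ℂ => fun i => u i (s i)) s₀ := by
      refine AnalyticAt.pi fun i => ?_
      exact AnalyticAt.fun_comp (f := fun s : Fin r → ℂ => s i) (hu i)
        ((ContinuousLinearMap.proj (R := ℂ) (φ := fun _ : Fin r => ℂ) i).analyticAt s₀)
    exact (ContinuousMultilinearMap.analyticAt (∑' n, ((w n : ℝ) : ℂ) • M n)).fun_comp h1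
  refine han.congr ?_
  have hev : ∀ᶠ s : Fin r → ℂ in 𝓝 s₀, ∀ i, ∀ n, u i (s i) n = f i n (s i) :=
    eventually_all.2 fun i => (continuous_apply i).continuousAt.eventually (huf i)
  filter_upwards [hev] with s hs
  have happ := (ContinuousMultilinearMap.apply ℂ (fun _ : Fin r => (ℕ →ᵇ ℂ)) ℂ
    fun i => u i (s i)).map_tsum hsum
  rw [ContinuousMultilinearMap.apply_apply] at happ
  rw [happ, multiSum]
  refine tsum_congr fun n => ?_
  rw [ContinuousMultilinearMap.apply_apply, _root_.smul_apply, hM, smul_eq_mul,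
    Complex.ofReal_prod, ← Finset.prod_mul_distrib]
  refine Finset.prod_congr rfl fun i _ => ?_
  have hn := n.2.2 i
  have hn' : (0 : ℝ) < n.1 i := by exact_mod_cast hn
  rw [hs, hf]
  simp only [hn.ne', if_false]
  rw [← mul_assoc, ← Complex.ofReal_mul, ← Real.rpow_add hn']
  simp

/-- A tuple of length `r + 2` is a tuple of length `r + 1` with a gap. -/
def tupleEquiv (r : ℕ) : Tuple (r + 1) × ℕ ≃ Tuple (r + 2) where
  toFun n := ⟨Fin.snoc (α := fun _ => ℕ) n.1.1 (n.1.1 (Fin.last r) + 1 + n.2), by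
    constructor
    · rw [Fin.strictMono_iff_lt_succ]
      intro i
      refine Fin.lastCases ?_ (fun j => ?_) i
      · rw [Fin.succ_last, Fin.snoc_castSucc (α := fun _ => ℕ), Fin.snoc_last (α := fun _ => ℕ)]
        omega
      · rw [← Fin.castSucc_succ, Fin.snoc_castSucc (α := fun _ => ℕ),
          Fin.snoc_castSucc (α := fun _ => ℕ)]
        exact n.1.2.1 j.castSucc_lt_succ
    · intro i
      refine Fin.lastCases ?_ (fun j => ?_) i
      · rw [Fin.snoc_last (α := fun _ => ℕ)]; omega
      · rw [Fin.snoc_castSucc (α := fun _ => ℕ)]; exact n.1.2.2 j⟩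
  invFun n := (⟨fun i => n.1 i.castSucc, n.2.1.comp Fin.strictMono_castSucc, fun i => n.2.2 _⟩,
    n.1 (Fin.last (r + 1)) - n.1 (Fin.last r).castSucc - 1)
  left_inv n := by
    ext
    · exact Fin.snoc_castSucc (α := fun _ => ℕ) _ _ _
    · dsimp only
      rw [Fin.snoc_castSucc (α := fun _ => ℕ), Fin.snoc_last (α := fun _ => ℕ)]
      omega
  right_inv n := by
    have := n.2.1 (Fin.castSucc_lt_last (Fin.last r))
    ext i
    refine Fin.lastCases ?_ (fun j => ?_) i
    · dsimp only
      rw [Fin.snoc_last (α := fun _ => ℕ)]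
      omega
    · exact Fin.snoc_castSucc (α := fun _ => ℕ) _ _ _

/-- Summation over the last index of a multiple series with telescoping last factor. -/
theorem tsum_telescope {r : ℕ} {a : Fin (r + 1) → ℕ → ℂ} {b : ℕ → ℂ} (hb : Tendsto b atTop (𝓝 0))
    (hs : Summable fun n : Tuple (r + 2) =>
      (∏ i, a i (n.1 i.castSucc)) * (b (n.1 (Fin.last _)) - b (n.1 (Fin.last _) - 1))) :
    ∑' n : Tuple (r + 2),
      (∏ i, a i (n.1 i.castSucc)) * (b (n.1 (Fin.last _)) - b (n.1 (Fin.last _) - 1)) =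
    -∑' n : Tuple (r + 1), (∏ i, a i (n.1 i)) * b (n.1 (Fin.last r)) := by
  rw [← (tupleEquiv r).summable_iff] at hs
  rw [← (tupleEquiv r).tsum_eq, ← tsum_neg]
  -- Sum over the gap first: the partial sums telescope to `b (K + n_{r-1}) - b (n_{r-1})`.
  refine Eq.trans hs.tsum_prod (tsum_congr fun n => ?_)
  have hlim : HasSum (fun k => ((fun n : Tuple (r + 2) => (∏ i, a i (n.1 i.castSucc)) *
      (b (n.1 (Fin.last _)) - b (n.1 (Fin.last _) - 1))) ∘ tupleEquiv r) (n, k))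
      (-((∏ i, a i (n.1 i)) * b (n.1 (Fin.last r)))) := by
    rw [(hs.prod_factor n).hasSum_iff_tendsto_nat]
    have hb' := ((hb.comp (tendsto_add_atTop_nat (n.1 (Fin.last r)))).sub_const
      (b (n.1 (Fin.last r)))).const_mul (∏ i, a i (n.1 i))
    rw [zero_sub, mul_neg] at hb'
    refine hb'.congr fun K => ?_
    have := Finset.sum_range_sub (fun k => b (k + n.1 (Fin.last r))) K
    simp only [zero_add] at this
    rw [Function.comp_apply, ← this, Finset.mul_sum]
    refine Finset.sum_congr rfl fun k _ => ?_
    simp only [tupleEquiv, Equiv.coe_fn_mk, Function.comp_apply]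
    have h1 : ∀ i : Fin (r + 1), (Fin.snoc (α := fun _ => ℕ) n.1 (n.1 (Fin.last r) + 1 + k) :
      Fin (r + 2) → ℕ) i.castSucc = n.1 i := fun i => Fin.snoc_castSucc (α := fun _ => ℕ) _ _ _
    have h2 : (Fin.snoc (α := fun _ => ℕ) n.1 (n.1 (Fin.last r) + 1 + k) :
      Fin (r + 2) → ℕ) (Fin.last _) = n.1 (Fin.last r) + 1 + k :=
      Fin.snoc_last (α := fun _ => ℕ) _ _
    simp only [h1, h2]
    rw [show n.1 (Fin.last r) + 1 + k = k + 1 + n.1 (Fin.last r) by omega,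
      show k + 1 + n.1 (Fin.last r) - 1 = k + n.1 (Fin.last r) by omega]
  exact hlim.tsum_eq

end MultipleSums

/-! ### The Euler–Maclaurin remainder term -/

/-- The rising factorial `(s)_i`. -/
noncomputable def poch (i : ℕ) (s : ℂ) : ℂ := (ascPochhammer ℂ i).eval s

/-- The coefficient `B_i / i!`. -/
noncomputable def bernoulliCoeff (i : ℕ) : ℂ := ((_root_.bernoulli i / i.factorial : ℚ) : ℂ)

theorem poch_zero (s : ℂ) : poch 0 s = 1 := by simp [poch]

theorem poch_succ (i : ℕ) (s : ℂ) : poch (i + 1) s = s * poch i (s + 1) := by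
  simp [poch, ascPochhammer_succ_left]

theorem poch_mul (i j : ℕ) (s : ℂ) : poch i s * poch j (s + i) = poch (i + j) s := by
  simp [poch, ← ascPochhammer_mul]

theorem differentiable_poch (i : ℕ) : Differentiable ℂ (poch i) :=
  (ascPochhammer ℂ i).differentiable

theorem poch_neg_natCast (b i : ℕ) : poch i (-(b : ℂ)) = (-1) ^ i * b.descFactorial i := by
  rw [poch, ascPochhammer_eval_neg_eq_descPochhammer, descPochhammer_eval_eq_descFactorial]

/-- The remainder of order `J` in the binomial expansion of `(1 - x) ^ (-e)`. -/
noncomputable def binomialRemainder (J : ℕ) (e : ℂ) (x : ℂ) : ℂ :=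
  (1 - x) ^ (-e) - ∑ j ∈ Finset.range J, poch j e / j.factorial * x ^ j

theorem hasDerivAt_binomialRemainder (J : ℕ) (e : ℂ) {x : ℂ} (hx : 1 - x ∈ Complex.slitPlane) :
    HasDerivAt (binomialRemainder (J + 1) e) (e * binomialRemainder J (e + 1) x) x := by
  have h1 : HasDerivAt (fun z : ℂ => (1 - z) ^ (-e)) (-e * (1 - x) ^ (-e - 1) * -1) x :=
    ((hasDerivAt_id x).const_sub 1).cpow_const hx
  have h2 : HasDerivAt (fun z : ℂ => ∑ j ∈ Finset.range (J + 1), poch j e / j.factorial * z ^ j)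
      (∑ j ∈ Finset.range (J + 1), poch j e / j.factorial * (j * x ^ (j - 1))) x :=
    HasDerivAt.fun_sum fun j _ => (hasDerivAt_pow j x).const_mul _
  convert! h1.sub h2 using 1
  rw [binomialRemainder, Finset.sum_range_succ', mul_sub, Finset.mul_sum]
  have h3 : ∀ j ∈ Finset.range J, e * (poch j (e + 1) / j.factorial * x ^ j) =
      poch (j + 1) e / (j + 1).factorial * ((j + 1 : ℕ) * x ^ (j + 1 - 1)) := fun j _ => by
    have hj : ((j : ℂ) + 1) ≠ 0 := by exact_mod_cast j.succ_ne_zero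
    have hf : (j.factorial : ℂ) ≠ 0 := by exact_mod_cast j.factorial_ne_zero
    rw [poch_succ, Nat.factorial_succ, Nat.add_sub_cancel]
    push_cast
    field_simp
  rw [Finset.sum_congr rfl h3, neg_add']
  simp

/-- Induction on `J` by the mean value inequality: the remainder vanishes at `0` and its derivative
is `e` times the remainder of lower order at `e + 1`. The bound is uniform over `‖e‖ ≤ A`, hence the
passage from `A` to `A + 1`. -/
theorem norm_binomialRemainder_le (J : ℕ) : ∀ A : ℝ, 0 ≤ A → ∃ C, 0 ≤ C ∧ ∀ e : ℂ, ‖e‖ ≤ A →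
    ∀ x : ℝ, 0 ≤ x → x ≤ 1 / 2 → ‖binomialRemainder J e x‖ ≤ C * x ^ J := by
  induction J with
  | zero =>
    intro A hA
    refine ⟨(1 / 2 : ℝ) ^ (-A), by positivity, fun e he x hx hx' => ?_⟩
    have h1 : (0 : ℝ) < 1 - x := by linarith
    simp only [binomialRemainder, Finset.range_zero, Finset.sum_empty, sub_zero, pow_zero, mul_one]
    rw [← Complex.ofReal_one, ← Complex.ofReal_sub, Complex.norm_cpow_eq_rpow_re_of_pos h1]
    calc (1 - x) ^ (-e).re ≤ (1 - x) ^ (-A) := by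
          refine Real.rpow_le_rpow_of_exponent_ge h1 (by linarith) ?_
          have := Complex.abs_re_le_norm e
          rw [Complex.neg_re]
          linarith [le_abs_self e.re]
      _ ≤ _ := Real.rpow_le_rpow_of_nonpos (by norm_num) (by linarith) (by linarith)
  | succ J ih =>
    intro A hA
    obtain ⟨C, hC, h⟩ := ih (A + 1) (by linarith)
    refine ⟨A * C, by positivity, fun e he x hx hx' => ?_⟩
    have h0 : binomialRemainder (J + 1) e 0 = 0 := by
      simp [binomialRemainder, Finset.sum_range_succ', poch_zero]
    have hd : ∀ y ∈ Set.Icc 0 x, HasDerivWithinAt (fun y : ℝ => binomialRemainder (J + 1) e y)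
        (e * binomialRemainder J (e + 1) y) (Set.Icc 0 x) y := fun y hy => by
      refine (hasDerivAt_binomialRemainder J e ?_).comp_ofReal.hasDerivWithinAt
      rw [← Complex.ofReal_one, ← Complex.ofReal_sub, Complex.ofReal_mem_slitPlane]
      linarith [hy.2]
    have hb : ∀ y ∈ Set.Icc 0 x, ‖e * binomialRemainder J (e + 1) y‖ ≤ A * (C * x ^ J) :=
      fun y hy => by
        rw [norm_mul]
        have h1 : ‖e + 1‖ ≤ A + 1 := (norm_add_le _ _).trans (by simpa using he)
        have h2 := h (e + 1) h1 y hy.1 (hy.2.trans hx')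
        have h3 : C * y ^ J ≤ C * x ^ J := by gcongr <;> [exact hy.1; exact hy.2]
        gcongr
        exact h2.trans h3
    have := (convex_Icc 0 x).norm_image_sub_le_of_norm_hasDerivWithin_le hd hb
      (Set.left_mem_Icc.2 hx) (Set.right_mem_Icc.2 hx)
    simp only [Complex.ofReal_zero, h0, sub_zero, Real.norm_of_nonneg hx] at this
    exact this.trans_eq (by ring)

/-- The term of the Euler–Maclaurin remainder: `(s - 1) n ^ (-s)`, minus the increment from `n` to
`n - 1` of the first `I` terms of the asymptotic expansion of `(s - 1) ∑_{m > n} m ^ (-s)`. -/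
noncomputable def emTerm (I n : ℕ) (s : ℂ) : ℂ :=
  if n ≤ 1 then 0 else (s - 1) * (n : ℂ) ^ (-s) + ∑ i ∈ Finset.range I,
    bernoulliCoeff i * poch i (s - 1) * ((n : ℂ) ^ (-(s - 1 + i)) - ((n - 1 : ℕ) : ℂ) ^ (-(s - 1 + i)))

theorem differentiable_natCast_cpow {n : ℕ} (hn : n ≠ 0) {f : ℂ → ℂ} (hf : Differentiable ℂ f) :
    Differentiable ℂ fun s => (n : ℂ) ^ f s :=
  hf.const_cpow (Or.inl (by exact_mod_cast hn))

theorem differentiable_emTerm (I n : ℕ) : Differentiable ℂ (emTerm I n) := by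
  unfold emTerm
  by_cases hn : n ≤ 1
  · simp [hn]
  simp only [hn, if_false]
  refine Differentiable.add ((differentiable_id.sub_const 1).mul
    (differentiable_natCast_cpow (by omega) differentiable_neg)) ?_
  refine Differentiable.fun_sum fun i _ => ?_
  have he : Differentiable ℂ fun s : ℂ => -(s - 1 + i) := by fun_prop
  refine Differentiable.mul ?_ ((differentiable_natCast_cpow (by omega) he).sub
    (differentiable_natCast_cpow (by omega) he))
  exact ((differentiable_poch i).comp (differentiable_id.sub_const 1)).const_mul _

/-- This is `t/(e^t - 1) · (e^t - 1) = t` read off coefficientwise. -/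
theorem sum_bernoulliCoeff_div (N : ℕ) :
    ∑ i ∈ Finset.range (N + 1), bernoulliCoeff i / ((N + 1 - i).factorial : ℂ) =
      if N = 0 then 1 else 0 := by
  have h := _root_.sum_bernoulli (N + 1)
  have hN : ((N + 1).factorial : ℚ) ≠ 0 := by exact_mod_cast (N + 1).factorial_ne_zero
  have : ∑ i ∈ Finset.range (N + 1), (_root_.bernoulli i / i.factorial) / ((N + 1 - i).factorial : ℚ) =
      if N = 0 then 1 else 0 := by
    have h1 : ∀ i ∈ Finset.range (N + 1), (_root_.bernoulli i / i.factorial) /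
        ((N + 1 - i).factorial : ℚ) = ((N + 1).choose i * _root_.bernoulli i) / (N + 1).factorial := by
      intro i hi
      rw [Nat.cast_choose ℚ (Finset.mem_range.1 hi).le]
      have h2 : (i.factorial : ℚ) ≠ 0 := by exact_mod_cast i.factorial_ne_zero
      have h3 : ((N + 1 - i).factorial : ℚ) ≠ 0 := by exact_mod_cast (N + 1 - i).factorial_ne_zero
      field_simp
    rw [Finset.sum_congr rfl h1, ← Finset.sum_div, h]
    by_cases h0 : N = 0 <;> simp [h0]
  have h2 := congrArg (fun q : ℚ => (q : ℂ)) this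
  simp only [Rat.cast_sum, Rat.cast_div, Rat.cast_natCast] at h2
  simp only [bernoulliCoeff, Rat.cast_div, Rat.cast_natCast]
  rw [h2]
  split_ifs <;> simp

/-- With `x = 1/n` and `e = s - 1`, expand `(1 - x) ^ (-(e + i))` up to total degree `I` in `x`. As
`(e)_i (e + i)_j = (e)_{i+j}`, the coefficient of `x ^ (N + 1)` contains the Bernoulli sum of
`sum_bernoulliCoeff_div`; only `N = 0` survives, and it cancels `(s - 1) n ^ (-s)`. The binomial
remainders that are left have total order `I + 1`. -/
theorem emTerm_eq {I n : ℕ} (hI : 1 ≤ I) (hn : 2 ≤ n) (s : ℂ) :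
    emTerm I n s = -((n : ℂ) ^ (-(s - 1)) * ∑ i ∈ Finset.range I, bernoulliCoeff i * poch i (s - 1) *
      ((n : ℂ)⁻¹ ^ i * binomialRemainder (I + 1 - i) (s - 1 + i) (n : ℂ)⁻¹)) := by
  set e := s - 1 with he
  set x : ℂ := (n : ℂ)⁻¹ with hx
  have hn0 : (n : ℂ) ≠ 0 := by exact_mod_cast (by omega : n ≠ 0)
  have h1 : ∀ i : ℕ, (n : ℂ) ^ (-(e + i)) = (n : ℂ) ^ (-e) * x ^ i := fun i => by
    rw [neg_add, Complex.cpow_add _ _ hn0, Complex.cpow_neg _ (i : ℂ), Complex.cpow_natCast, hx,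
      inv_pow]
  have h2 : ∀ i : ℕ, ((n - 1 : ℕ) : ℂ) ^ (-(e + i)) =
      (n : ℂ) ^ (-e) * x ^ i * (1 - x) ^ (-(e + i)) := fun i => by
    have h3 : ((n - 1 : ℕ) : ℂ) = ((n : ℝ) : ℂ) * ((1 - (n : ℝ)⁻¹ : ℝ) : ℂ) := by
      rw [Nat.cast_sub (by omega)]
      push_cast
      field_simp
    have h4 : (0 : ℝ) ≤ 1 - (n : ℝ)⁻¹ :=
      sub_nonneg.2 (inv_le_one_of_one_le₀ (by exact_mod_cast (by omega : 1 ≤ n)))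
    rw [h3, Complex.mul_cpow_ofReal_nonneg (by positivity) h4, Complex.ofReal_natCast, h1, hx]
    push_cast
    rfl
  have h5 : (n : ℂ) ^ (-s) = (n : ℂ) ^ (-e) * x := by
    have := h1 1
    rw [pow_one] at this
    rw [← this, he]
    congr 1
    push_cast
    ring
  have h6 : ∀ i ∈ Finset.range I, (1 - x) ^ (-(e + i)) = 1 + binomialRemainder (I + 1 - i) (e + i) x +
      ∑ j ∈ Finset.range (I - i), poch (j + 1) (e + i) / (j + 1).factorial * x ^ (j + 1) := by
    intro i hi
    rw [binomialRemainder, show I + 1 - i = I - i + 1 by have := Finset.mem_range.1 hi; omega,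
      Finset.sum_range_succ']
    simp only [poch_zero, Nat.factorial_zero, Nat.cast_one, pow_zero]
    ring
  have h7 : ∑ i ∈ Finset.range I, ∑ j ∈ Finset.range (I - i), bernoulliCoeff i * poch i e * x ^ i *
      (poch (j + 1) (e + i) / (j + 1).factorial * x ^ (j + 1)) = e * x := by
    rw [← Finset.sum_range_diag_flip I (fun i j => bernoulliCoeff i * poch i e * x ^ i *
      (poch (j + 1) (e + i) / (j + 1).factorial * x ^ (j + 1)))]
    have h8 : ∀ N ∈ Finset.range I, ∑ i ∈ Finset.range (N + 1), bernoulliCoeff i * poch i e * x ^ i *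
        (poch (N - i + 1) (e + i) / (N - i + 1).factorial * x ^ (N - i + 1)) =
        if N = 0 then e * x else 0 := by
      intro N _
      have h9 : ∀ i ∈ Finset.range (N + 1), bernoulliCoeff i * poch i e * x ^ i *
        (poch (N - i + 1) (e + i) / (N - i + 1).factorial * x ^ (N - i + 1)) =
        poch (N + 1) e * x ^ (N + 1) * (bernoulliCoeff i / ((N + 1 - i).factorial : ℂ)) := by
        intro i hi
        have hi' := Finset.mem_range.1 hi
        have e1 : N - i + 1 = N + 1 - i := by omega
        have e2 : i + (N + 1 - i) = N + 1 := by omega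
        rw [e1]
        conv_rhs => rw [← e2, ← poch_mul, pow_add, e2]
        ring
      rw [Finset.sum_congr rfl h9, ← Finset.mul_sum, sum_bernoulliCoeff_div]
      by_cases hN : N = 0
      · simp [hN, poch_succ, poch_zero]
      · simp [hN]
    rw [Finset.sum_congr rfl h8, Finset.sum_ite_eq' (Finset.range I) 0]
    simp; omega
  rw [emTerm, if_neg (by omega), h5, ← he]
  have h10 : ∀ i ∈ Finset.range I, bernoulliCoeff i * poch i e *
      ((n : ℂ) ^ (-(e + i)) - ((n - 1 : ℕ) : ℂ) ^ (-(e + i))) =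
      -((n : ℂ) ^ (-e) * (bernoulliCoeff i * poch i e * (x ^ i * binomialRemainder (I + 1 - i) (e + i) x)))
      - (n : ℂ) ^ (-e) * ∑ j ∈ Finset.range (I - i), bernoulliCoeff i * poch i e * x ^ i *
      (poch (j + 1) (e + i) / (j + 1).factorial * x ^ (j + 1)) := by
    intro i hi
    rw [h2, h1, h6 i hi, ← Finset.mul_sum]
    ring
  rw [Finset.sum_congr rfl h10, Finset.sum_sub_distrib, ← Finset.mul_sum, h7, Finset.sum_neg_distrib,
    ← Finset.mul_sum]
  ring

theorem norm_natCast_cpow {n : ℕ} (hn : 1 ≤ n) (s : ℂ) : ‖(n : ℂ) ^ s‖ = (n : ℝ) ^ s.re :=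
  Complex.norm_natCast_cpow_of_pos hn s

theorem norm_emTerm_le_rpow (I : ℕ) (s₀ : ℂ) : ∃ D, 0 ≤ D ∧ ∀ᶠ s in 𝓝 s₀, ∀ n : ℕ, 2 ≤ n →
    ‖emTerm I n s‖ ≤ D * (n : ℝ) ^ (-(s.re + I)) := by
  have hA : ∀ᶠ s in 𝓝 s₀, ‖s - 1‖ ≤ ‖s₀ - 1‖ + 1 := by
    have : ContinuousAt (fun s : ℂ => ‖s - 1‖) s₀ := by fun_prop
    exact (this.eventually (gt_mem_nhds (lt_add_one _))).mono fun _ h => le_of_lt h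
  -- For `I = 0` the term is `(s - 1) n ^ (-s)` itself, outside the scope of `emTerm_eq`.
  rcases Nat.eq_zero_or_pos I with rfl | hI
  · refine ⟨‖s₀ - 1‖ + 1, by positivity, ?_⟩
    filter_upwards [hA] with s hs n hn
    simp only [emTerm, if_neg (by omega : ¬ n ≤ 1), Finset.range_zero, Finset.sum_empty, add_zero,
      norm_mul, norm_natCast_cpow (by omega : 1 ≤ n), Nat.cast_zero, Complex.neg_re]
    gcongr
  have hK : ∀ᶠ s in 𝓝 s₀, ∀ i : Fin I, ‖poch i (s - 1)‖ ≤ ‖poch i (s₀ - 1)‖ + 1 := by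
    refine eventually_all.2 fun i => ?_
    have : ContinuousAt (fun s : ℂ => ‖poch i (s - 1)‖) s₀ :=
      ((differentiable_poch i).continuous.comp (continuous_id.sub continuous_const)).norm.continuousAt
    exact (this.eventually (gt_mem_nhds (lt_add_one _))).mono fun _ h => le_of_lt h
  choose C hC0 hC using fun i : ℕ => norm_binomialRemainder_le (I + 1 - i) (‖s₀ - 1‖ + 1 + i)
    (by positivity)
  refine ⟨∑ i ∈ Finset.range I, ‖bernoulliCoeff i‖ * (‖poch i (s₀ - 1)‖ + 1) * C i,
    Finset.sum_nonneg fun i _ => mul_nonneg (by positivity) (hC0 i), ?_⟩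
  filter_upwards [hA, hK] with s hs hs' n hn
  have hn0 : (0 : ℝ) < n := by exact_mod_cast (by omega : 0 < n)
  have hx : (n : ℝ)⁻¹ ≤ 1 / 2 := by
    rw [one_div]
    exact inv_anti₀ (by norm_num) (by exact_mod_cast hn)
  have hpow : (n : ℝ) ^ (-(s - 1)).re * (n : ℝ)⁻¹ ^ (I + 1) = (n : ℝ) ^ (-(s.re + I)) := by
    rw [inv_pow, ← Real.rpow_natCast, ← Real.rpow_neg hn0.le, ← Real.rpow_add hn0]
    congr 1
    simp
    ring
  rw [emTerm_eq hI hn, norm_neg, norm_mul, norm_natCast_cpow (by omega), ← hpow, mul_left_comm]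
  refine mul_le_mul_of_nonneg_left ((norm_sum_le _ _).trans ?_) (by positivity)
  rw [Finset.sum_mul]
  refine Finset.sum_le_sum fun i hi => ?_
  have hi' := Finset.mem_range.1 hi
  have hb := hC i (s - 1 + i) ((norm_add_le _ _).trans (by simpa using hs)) (n : ℝ)⁻¹
    (by positivity) hx
  have hp := hs' ⟨i, hi'⟩
  rw [Complex.ofReal_inv, Complex.ofReal_natCast] at hb
  rw [norm_mul, norm_mul, norm_mul, norm_pow, norm_inv, Complex.norm_natCast]
  calc _ ≤ ‖bernoulliCoeff i‖ * (‖poch i (s₀ - 1)‖ + 1) *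
        ((n : ℝ)⁻¹ ^ i * (C i * (n : ℝ)⁻¹ ^ (I + 1 - i))) := by gcongr
    _ = _ := by
      rw [mul_left_comm ((n : ℝ)⁻¹ ^ i), ← pow_add, Nat.add_sub_cancel' (by omega)]
      ring

theorem norm_emTerm_le (I : ℕ) {s₀ : ℂ} {c : ℝ} (hc : c < s₀.re + I) : ∃ C, ∀ᶠ s in 𝓝 s₀,
    ∀ n : ℕ, 1 ≤ n → ‖emTerm I n s‖ ≤ C * (n : ℝ) ^ (-c) := by
  obtain ⟨D, hD, h⟩ := norm_emTerm_le_rpow I s₀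
  refine ⟨D, ?_⟩
  have hc' : ∀ᶠ s : ℂ in 𝓝 s₀, c < s.re + I := by
    have : ContinuousAt (fun s : ℂ => s.re + I) s₀ := by fun_prop
    exact this.eventually (lt_mem_nhds hc)
  filter_upwards [h, hc'] with s hs hs' n hn
  rcases hn.eq_or_lt with rfl | hn'
  · simp [emTerm, hD]
  · refine (hs n hn').trans ?_
    gcongr
    exact_mod_cast hn

theorem norm_cpow_neg_le {s₀ : ℂ} {c : ℝ} (hc : c < s₀.re) : ∃ C : ℝ, ∀ᶠ s in 𝓝 s₀,
    ∀ n : ℕ, 1 ≤ n → ‖(n : ℂ) ^ (-s)‖ ≤ C * (n : ℝ) ^ (-c) := by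
  refine ⟨1, ?_⟩
  filter_upwards [Complex.continuous_re.continuousAt.eventually (lt_mem_nhds hc)] with s hs n hn
  rw [norm_natCast_cpow hn, one_mul, Complex.neg_re]
  gcongr
  exact_mod_cast hn

theorem sum_bernoulli_alternating (b : ℕ) (z : ℚ) :
    ∑ i ∈ Finset.range (b + 2), (-1) ^ i * (b + 1).choose i * _root_.bernoulli i * z ^ (b + 1 - i) =
      (-1) ^ (b + 1) * (Polynomial.bernoulli (b + 1)).eval (-z) := by
  rw [Polynomial.bernoulli, eval_finsetSum, Finset.mul_sum]
  refine Finset.sum_congr rfl fun i hi => ?_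
  have hi' : i ≤ b + 1 := by have := Finset.mem_range.1 hi; omega
  rw [eval_monomial, neg_pow z]
  have : (-1 : ℚ) ^ (b + 1) * (-1) ^ (b + 1 - i) = (-1) ^ i := by
    have e : b + 1 = i + (b + 1 - i) := by omega
    nth_rewrite 1 [e]
    rw [pow_add, mul_assoc, ← mul_pow]
    simp
  rw [← this]
  ring

/-- Faulhaber's formula: the terms with `i ≥ b + 2` vanish, and the others sum to a multiple of
`B_{b+1}(1 - n) - B_{b+1}(-n) = (b + 1)(-n)^b`. -/
theorem emTerm_neg_natCast {b I : ℕ} (h : b + 2 ≤ I) (n : ℕ) : emTerm I n (-(b : ℂ)) = 0 := by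
  rw [emTerm]
  split_ifs with hn
  · rfl
  have hs : -(b : ℂ) - 1 = -((b + 1 : ℕ) : ℂ) := by push_cast; ring
  rw [hs]
  have hcoef : ∀ i, bernoulliCoeff i * poch i (-((b + 1 : ℕ) : ℂ)) =
      (((-1) ^ i * (b + 1).choose i * _root_.bernoulli i : ℚ) : ℂ) := by
    intro i
    have hf : (i.factorial : ℂ) ≠ 0 := by exact_mod_cast i.factorial_ne_zero
    rw [poch_neg_natCast, Nat.descFactorial_eq_factorial_mul_choose, bernoulliCoeff]
    push_cast
    field_simp
  have hsub : Finset.range (b + 2) ⊆ Finset.range I := Finset.range_subset_range.2 h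
  rw [← Finset.sum_subset hsub]
  · have hpow : ∀ (m : ℕ), ∀ i ∈ Finset.range (b + 2),
        (m : ℂ) ^ (-(-((b + 1 : ℕ) : ℂ) + i)) = (((m : ℚ) ^ (b + 1 - i) : ℚ) : ℂ) := by
      intro m i hi
      have hi' : i ≤ b + 1 := by have := Finset.mem_range.1 hi; omega
      rw [show -(-((b + 1 : ℕ) : ℂ) + i) = ((b + 1 - i : ℕ) : ℂ) by
        rw [Nat.cast_sub hi']; ring, Complex.cpow_natCast]
      push_cast
      rfl
    have hq : -((b + 1 : ℕ) : ℚ) * (n : ℚ) ^ b + ∑ i ∈ Finset.range (b + 2),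
        ((-1) ^ i * (b + 1).choose i * _root_.bernoulli i) *
          ((n : ℚ) ^ (b + 1 - i) - ((n - 1 : ℕ) : ℚ) ^ (b + 1 - i)) = 0 := by
      simp only [mul_sub, Finset.sum_sub_distrib, sum_bernoulli_alternating]
      rw [Nat.cast_sub (by omega), show -((n : ℚ) - (1 : ℕ)) = 1 + -(n : ℚ) by push_cast; ring,
        Polynomial.bernoulli_eval_one_add, Nat.add_sub_cancel, neg_pow (n : ℚ)]
      have : (-1 : ℚ) ^ (b + 1) * (-1) ^ b = -1 := by
        rw [pow_succ, mul_right_comm, ← mul_pow]; simp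
      linear_combination -((b + 1 : ℕ) : ℚ) * (n : ℚ) ^ b * this
    rw [Finset.sum_congr rfl fun i hi => by rw [hcoef, hpow n i hi, hpow (n - 1) i hi], neg_neg,
      Complex.cpow_natCast]
    exact_mod_cast congrArg (fun q : ℚ => (q : ℂ)) hq
  · intro i _ hi
    have : b + 1 < i := by rw [Finset.mem_range] at hi; omega
    rw [poch_neg_natCast, Nat.descFactorial_of_lt this]
    simp

/-! ### Meromorphic continuation by induction on the depth -/

section Continuation

variable {r : ℕ}

theorem sum_Ici_add_ite_last {M : Type*} [AddCommMonoid M] (f : Fin (r + 1) → M) (v : M)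
    (j : Fin (r + 1)) :
    ∑ i ∈ Finset.Ici j, (f i + if i = Fin.last r then v else 0) = ∑ i ∈ Finset.Ici j, f i + v := by
  rw [Finset.sum_add_distrib, Finset.sum_ite_eq', if_pos (Finset.mem_Ici.2 (Fin.le_last j))]

theorem sum_Ici_castSucc {M : Type*} [AddCommMonoid M] (f : Fin (r + 1) → M) (j : Fin r) :
    ∑ i ∈ Finset.Ici j.castSucc, f i = ∑ i ∈ Finset.Ici j, f i.castSucc + f (Fin.last r) := by
  have h1 : ∀ (m : ℕ) (k : Fin m) (g : Fin m → M), ∑ i ∈ Finset.Ici k, g i =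
      ∑ i, if k ≤ i then g i else 0 := fun m k g => by
    rw [← Finset.sum_filter]
    congr 1
    ext; simp
  rw [h1, h1, Fin.sum_univ_castSucc, if_pos (Fin.le_last _)]
  simp

/-- The shifted argument: the last two variables are merged into one. -/
def merge (i : ℕ) (s : Fin (r + 2) → ℂ) : Fin (r + 1) → ℂ := fun j =>
  s j.castSucc + if j = Fin.last r then s (Fin.last (r + 1)) - 1 + i else 0

theorem sum_Ici_merge (i : ℕ) (s : Fin (r + 2) → ℂ) (j : Fin (r + 1)) :
    ∑ k ∈ Finset.Ici j, merge i s k = ∑ k ∈ Finset.Ici j.castSucc, s k - 1 + i := by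
  simp only [merge]
  rw [sum_Ici_add_ite_last, sum_Ici_castSucc]
  ring

theorem analyticAt_apply {m : ℕ} (i : Fin m) (s : Fin m → ℂ) :
    AnalyticAt ℂ (fun s : Fin m → ℂ => s i) s :=
  (ContinuousLinearMap.proj (R := ℂ) (φ := fun _ : Fin m => ℂ) i).analyticAt s

theorem analyticAt_merge (i : ℕ) (s : Fin (r + 2) → ℂ) : AnalyticAt ℂ (merge i) s := by
  refine AnalyticAt.pi fun j => (analyticAt_apply _ s).add ?_
  split_ifs
  · exact ((analyticAt_apply _ s).sub analyticAt_const).add analyticAt_const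
  · exact analyticAt_const

theorem isOpenMap_merge (i : ℕ) : IsOpenMap (merge (r := r) i) := by
  let L : (Fin (r + 2) → ℂ) →L[ℂ] (Fin (r + 1) → ℂ) := ContinuousLinearMap.pi fun j =>
    ContinuousLinearMap.proj (R := ℂ) (φ := fun _ : Fin (r + 2) => ℂ) j.castSucc +
      if j = Fin.last r then ContinuousLinearMap.proj (Fin.last (r + 1)) else 0
  have hL : Function.Surjective L := fun t => by
    refine ⟨Fin.snoc (α := fun _ => ℂ) t 0, funext fun j => ?_⟩
    by_cases hj : j = Fin.last r
    · subst hj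
      simp only [L, ContinuousLinearMap.coe_pi', if_true, _root_.add_apply,
        ContinuousLinearMap.proj_apply]
      rw [Fin.snoc_castSucc (α := fun _ => ℂ), Fin.snoc_last (α := fun _ => ℂ), add_zero]
    · simp only [L, ContinuousLinearMap.coe_pi', if_neg hj, add_zero,
        ContinuousLinearMap.proj_apply]
      exact Fin.snoc_castSucc (α := fun _ => ℂ) _ _ _
  have h := (Homeomorph.addRight (fun j : Fin (r + 1) => if j = Fin.last r then -1 + (i : ℂ) else 0)
    ).isOpenMap.comp (L.isOpenMap hL)
  convert! h using 1
  funext s j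
  by_cases hj : j = Fin.last r
  · simp [merge, L, hj]; ring
  · simp [merge, L, hj]

/-- The region in which the remainder of order `I` is holomorphic. -/
def shiftRegion (r I : ℕ) : Set (Fin (r + 1) → ℂ) :=
  {s | ∀ j : Fin (r + 1), ((r + 1 : ℕ) : ℝ) - (j : ℕ) < (∑ i ∈ Finset.Ici j, s i).re + I}

theorem isOpen_shiftRegion (r I : ℕ) : IsOpen (shiftRegion r I) := by
  simp only [shiftRegion, Set.ofPred_forall]
  refine isOpen_iInter_of_finite fun j => isOpen_lt continuous_const ?_
  fun_prop

theorem shiftRegion_zero (r : ℕ) : shiftRegion r 0 = convergenceRegion (r + 1) := by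
  simp [shiftRegion, convergenceRegion]

theorem shiftRegion_mono (r : ℕ) {I J : ℕ} (h : I ≤ J) : shiftRegion r I ⊆ shiftRegion r J :=
  fun s hs j => (hs j).trans_le (by gcongr)

theorem exists_mem_shiftRegion (s : Fin (r + 1) → ℂ) : ∃ I, s ∈ shiftRegion r I := by
  have : ∀ j : Fin (r + 1), ∀ᶠ I : ℕ in atTop,
      ((r + 1 : ℕ) : ℝ) - (j : ℕ) < (∑ i ∈ Finset.Ici j, s i).re + I := fun j => by
    filter_upwards [tendsto_natCast_atTop_atTop.eventually_gt_atTop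
      (((r + 1 : ℕ) : ℝ) - (j : ℕ) - (∑ i ∈ Finset.Ici j, s i).re)] with I hI
    linarith
  exact (eventually_all.2 this).exists

/-- The decay gained by `emTerm` sits in the last variable, which belongs to every tail sum. -/
theorem tailRegion_of_mem_shiftRegion {I : ℕ} {s : Fin (r + 1) → ℂ} (hs : s ∈ shiftRegion r I) :
    tailRegion fun i => (s i).re + if i = Fin.last r then (I : ℝ) else 0 := by
  intro j
  rw [sum_Ici_add_ite_last]
  simpa using hs j

theorem merge_mem_convergenceRegion {I : ℕ} {s : Fin (r + 2) → ℂ} (hs : s ∈ shiftRegion (r + 1) I) :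
    merge I s ∈ convergenceRegion (r + 1) := by
  intro j
  have := hs j.castSucc
  rw [sum_Ici_merge]
  simp only [Complex.add_re, Complex.sub_re, Complex.one_re, Complex.natCast_re, Fin.val_castSucc,
    Nat.cast_add, Nat.cast_one] at this ⊢
  linarith

/-- The factors of the terms of the remainder series. -/
noncomputable def emFactor (r I : ℕ) : Fin (r + 1) → ℕ → ℂ → ℂ :=
  Fin.snoc (α := fun _ => ℕ → ℂ → ℂ) (fun _ n s => (n : ℂ) ^ (-s)) (emTerm I)

theorem emFactor_castSucc (r I : ℕ) (i : Fin r) :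
    emFactor r I i.castSucc = fun (n : ℕ) (s : ℂ) => (n : ℂ) ^ (-s) :=
  Fin.snoc_castSucc (α := fun _ => ℕ → ℂ → ℂ) _ _ _

theorem emFactor_last (r I : ℕ) : emFactor r I (Fin.last r) = emTerm I :=
  Fin.snoc_last (α := fun _ => ℕ → ℂ → ℂ) _ _

/-- The remainder of the Euler–Maclaurin expansion of `s_r - 1` times the multiple zeta series. -/
noncomputable def remainder (r I : ℕ) (s : Fin (r + 1) → ℂ) : ℂ :=
  multiSum fun i n => emFactor r I i n (s i)

theorem norm_emFactor_le {I : ℕ} (s : Fin (r + 1) → ℂ) {η : ℝ} (hη : 0 < η) (i : Fin (r + 1)) :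
    ∃ C, ∀ᶠ z in 𝓝 (s i), ∀ n : ℕ, 1 ≤ n → ‖emFactor r I i n z‖ ≤
      C * (n : ℝ) ^ (-((s i).re + (if i = Fin.last r then (I : ℝ) else 0) - η)) := by
  refine Fin.lastCases ?_ (fun j => ?_) i
  · simp only [emFactor_last, if_true]
    exact norm_emTerm_le I (by linarith)
  · simp only [emFactor_castSucc, (Fin.castSucc_lt_last j).ne, if_false]
    exact norm_cpow_neg_le (by linarith)

theorem differentiable_emFactor (r I : ℕ) (i : Fin (r + 1)) {n : ℕ} (hn : 1 ≤ n) :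
    Differentiable ℂ (emFactor r I i n) := by
  refine Fin.lastCases ?_ (fun j => ?_) i
  · rw [emFactor_last]
    exact differentiable_emTerm I n
  · rw [emFactor_castSucc]
    exact differentiable_natCast_cpow (by omega) differentiable_neg

theorem analyticAt_remainder {I : ℕ} {s : Fin (r + 1) → ℂ} (hs : s ∈ shiftRegion r I) :
    AnalyticAt ℂ (remainder r I) s := by
  obtain ⟨η, hη, hc⟩ := (tailRegion_of_mem_shiftRegion hs).exists_sub
  exact analyticAt_multiSum (fun i n hn => differentiable_emFactor r I i hn) hc
    (norm_emFactor_le s hη)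

theorem prod_emFactor (I : ℕ) (s : Fin (r + 1) → ℂ) (n : Fin (r + 1) → ℕ) :
    ∏ i, emFactor r I i (n i) (s i) =
      (∏ i : Fin r, (n i.castSucc : ℂ) ^ (-s i.castSucc)) *
        emTerm I (n (Fin.last r)) (s (Fin.last r)) := by
  rw [Fin.prod_univ_castSucc, emFactor_last]
  simp only [emFactor_castSucc]

theorem summable_remainder {I : ℕ} {s : Fin (r + 1) → ℂ} (hs : s ∈ shiftRegion r I) :
    Summable fun n : Tuple (r + 1) => (∏ i : Fin r, (n.1 i.castSucc : ℂ) ^ (-s i.castSucc)) *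
        emTerm I (n.1 (Fin.last r)) (s (Fin.last r)) := by
  obtain ⟨η, hη, hc⟩ := (tailRegion_of_mem_shiftRegion hs).exists_sub
  have := summable_multiSum (a := fun i n => emFactor r I i n (s i)) hc fun i => by
    obtain ⟨C, hC⟩ := norm_emFactor_le (I := I) s hη i
    exact ⟨C, hC.self_of_nhds⟩
  simpa only [prod_emFactor] using this

theorem remainder_eq (I : ℕ) (s : Fin (r + 1) → ℂ) : remainder r I s = ∑' n : Tuple (r + 1),
    (∏ i : Fin r, (n.1 i.castSucc : ℂ) ^ (-s i.castSucc)) *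
        emTerm I (n.1 (Fin.last r)) (s (Fin.last r)) := by
  simp only [remainder, multiSum, prod_emFactor]

theorem summable_zeta {s : Fin r → ℂ} (hs : s ∈ convergenceRegion r) :
    Summable fun n : Tuple r => ∏ i, (n.1 i : ℂ) ^ (-s i) := by
  obtain ⟨η, hη, hc⟩ := (mem_convergenceRegion.1 hs).exists_sub
  refine summable_multiSum (a := fun i n => (n : ℂ) ^ (-s i)) hc fun i => ?_
  obtain ⟨C, hC⟩ := norm_cpow_neg_le (sub_lt_self (s i).re hη)
  exact ⟨C, hC.self_of_nhds⟩

theorem prod_cpow_merge (I : ℕ) (s : Fin (r + 2) → ℂ) (n : Tuple (r + 1)) :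
    ∏ i, (n.1 i : ℂ) ^ (-merge I s i) = (∏ i, (n.1 i : ℂ) ^ (-s i.castSucc)) *
      (n.1 (Fin.last r) : ℂ) ^ (-(s (Fin.last (r + 1)) - 1 + I)) := by
  have h : ∀ i, (n.1 i : ℂ) ^ (-merge I s i) = (n.1 i : ℂ) ^ (-s i.castSucc) *
      if i = Fin.last r then (n.1 i : ℂ) ^ (-(s (Fin.last (r + 1)) - 1 + I)) else 1 := fun i => by
    have hn : (n.1 i : ℂ) ≠ 0 := by exact_mod_cast (n.2.2 i).ne'
    rw [merge]
    split_ifs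
    · rw [← Complex.cpow_add _ _ hn, neg_add]
    · rw [add_zero, mul_one]
  simp only [h]
  rw [Finset.prod_mul_distrib, Finset.prod_ite_eq', if_pos (Finset.mem_univ _)]

theorem last_lt_re {I : ℕ} {s : Fin (r + 1) → ℂ} (hs : s ∈ shiftRegion r I) :
    1 < (s (Fin.last r)).re + I := by
  have := hs (Fin.last r)
  have h : Finset.Ici (Fin.last r) = {Fin.last r} := by ext; simp [Fin.last_le_iff]
  rw [h] at this
  simpa using this

theorem emTerm_succ (I : ℕ) {n : ℕ} (hn : 2 ≤ n) (s : ℂ) :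
    emTerm (I + 1) n s = emTerm I n s + bernoulliCoeff I * poch I (s - 1) *
      ((n : ℂ) ^ (-(s - 1 + I)) - ((n - 1 : ℕ) : ℂ) ^ (-(s - 1 + I))) := by
  rw [emTerm, emTerm, if_neg (by omega), if_neg (by omega), Finset.sum_range_succ, add_assoc]

/-- In depth at least two the cutoff of `emTerm` at `n ≤ 1`, which avoids powers of `0`, therefore
never affects the remainder. -/
theorem Tuple.two_le_last (n : Tuple (r + 2)) : 2 ≤ n.1 (Fin.last (r + 1)) := by
  have h1 := n.2.2 (Fin.last r).castSucc
  have h2 := n.2.1 (Fin.castSucc_lt_last (Fin.last r))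
  omega

/-- Raising `I` by one changes the remainder by a series whose last factor telescopes; its sum is,
up to sign, the next term of the expansion. -/
theorem remainder_succ {I : ℕ} {s : Fin (r + 2) → ℂ} (hs : s ∈ shiftRegion (r + 1) I) :
    bernoulliCoeff I * poch I (s (Fin.last (r + 1)) - 1) *
      (∑' n : Tuple (r + 1), ∏ i, (n.1 i : ℂ) ^ (-merge I s i)) + remainder (r + 1) (I + 1) s =
    remainder (r + 1) I s := by
  set e := s (Fin.last (r + 1)) - 1 + I with he
  set c := bernoulliCoeff I * poch I (s (Fin.last (r + 1)) - 1) with hc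
  have hre : 0 < e.re := by
    have := last_lt_re hs
    simp only [he, Complex.add_re, Complex.sub_re, Complex.one_re, Complex.natCast_re]
    linarith
  have hs' := shiftRegion_mono (r + 1) (Nat.le_succ I) hs
  have hsub := (summable_remainder hs').sub (summable_remainder hs)
  have hdiff : ∀ n : Tuple (r + 2),
      (∏ i : Fin (r + 1), (n.1 i.castSucc : ℂ) ^ (-s i.castSucc)) *
        emTerm (I + 1) (n.1 (Fin.last _)) (s (Fin.last _)) -
      (∏ i : Fin (r + 1), (n.1 i.castSucc : ℂ) ^ (-s i.castSucc)) *
        emTerm I (n.1 (Fin.last _)) (s (Fin.last _)) =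
      c * ((∏ i : Fin (r + 1), (n.1 i.castSucc : ℂ) ^ (-s i.castSucc)) *
        ((n.1 (Fin.last _) : ℂ) ^ (-e) - ((n.1 (Fin.last _) - 1 : ℕ) : ℂ) ^ (-e))) := fun n => by
    rw [emTerm_succ I n.two_le_last]
    ring
  simp only [Nat.succ_eq_add_one, hdiff] at hsub
  have key : remainder (r + 1) (I + 1) s - remainder (r + 1) I s =
      c * -(∑' n : Tuple (r + 1), ∏ i, (n.1 i : ℂ) ^ (-merge I s i)) := by
    rw [remainder_eq, remainder_eq, ← (summable_remainder hs').tsum_sub (summable_remainder hs)]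
    simp only [Nat.succ_eq_add_one, hdiff, prod_cpow_merge]
    -- Summability is known only for `c` times the telescoping series, so `c` must be invertible to
    -- remove it.
    by_cases hc0 : c = 0
    · simp [hc0]
    rw [tsum_mul_left]
    congr 1
    refine tsum_telescope (a := fun i n => (n : ℂ) ^ (-s i.castSucc))
      (b := fun n => (n : ℂ) ^ (-e)) ?_ ((summable_mul_left_iff hc0).1 hsub)
    rw [tendsto_zero_iff_norm_tendsto_zero]
    refine ((tendsto_rpow_neg_atTop hre).comp tendsto_natCast_atTop_atTop).congr' ?_
    filter_upwards [eventually_ge_atTop 1] with n hn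
    rw [norm_natCast_cpow hn]
    rfl
  linear_combination key

open Classical in
/-- The multiple zeta function of depth `r + 1`, with arbitrary values on the polar set. -/
noncomputable def mz : (r : ℕ) → (Fin (r + 1) → ℂ) → ℂ
  | 0, s => riemannZeta (s 0)
  | r + 1, s =>
    (∑ i ∈ Finset.range (Nat.find (exists_mem_shiftRegion s)),
        bernoulliCoeff i * poch i (s (Fin.last (r + 1)) - 1) * mz r (merge i s) +
      remainder (r + 1) (Nat.find (exists_mem_shiftRegion s)) s) / (s (Fin.last (r + 1)) - 1)

/-- The Euler–Maclaurin expansion of `(s_r - 1) ζ(s_1, …, s_r)`. -/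
noncomputable def emSum (r I : ℕ) (s : Fin (r + 2) → ℂ) : ℂ :=
  ∑ i ∈ Finset.range I, bernoulliCoeff i * poch i (s (Fin.last (r + 1)) - 1) * mz r (merge i s) +
    remainder (r + 1) I s

theorem emSum_eq_of_le
    (h : ∀ s ∈ convergenceRegion (r + 1), mz r s = ∑' n : Tuple (r + 1), ∏ i, (n.1 i : ℂ) ^ (-s i))
    {I J : ℕ} {s : Fin (r + 2) → ℂ} (hs : s ∈ shiftRegion (r + 1) I) (hIJ : I ≤ J) :
    emSum r J s = emSum r I s := by
  induction J, hIJ using Nat.le_induction with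
  | base => rfl
  | succ J hJ ih =>
    have hsJ := shiftRegion_mono _ hJ hs
    rw [← ih, emSum, emSum, Finset.sum_range_succ, h _ (merge_mem_convergenceRegion hsJ), add_assoc,
      remainder_succ hsJ]

/-- Any admissible `I` may replace the least one chosen in `mz`, so a single `I` serves a whole
neighbourhood. The series formula in lower depth is a hypothesis because its own inductive proof
uses this lemma. -/
theorem mz_succ_of_tsum
    (h : ∀ s ∈ convergenceRegion (r + 1), mz r s = ∑' n : Tuple (r + 1), ∏ i, (n.1 i : ℂ) ^ (-s i))
    {I : ℕ} {s : Fin (r + 2) → ℂ} (hs : s ∈ shiftRegion (r + 1) I) :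
    mz (r + 1) s = emSum r I s / (s (Fin.last (r + 1)) - 1) := by
  classical
  rw [emSum_eq_of_le h (Nat.find_spec (exists_mem_shiftRegion s)) (Nat.find_min' _ hs), mz, emSum]

/-- The tuples of length one are the positive integers. -/
def tupleOneEquiv : ℕ ≃ Tuple 1 where
  toFun n := ⟨fun _ => n + 1, Subsingleton.strictMono _, fun _ => n.succ_pos⟩
  invFun n := n.1 0 - 1
  left_inv n := rfl
  right_inv n := by
    ext i
    have := n.2.2 0
    rw [Subsingleton.elim i 0]
    dsimp only
    omega

theorem mz_eq_tsum (r : ℕ) : ∀ s ∈ convergenceRegion (r + 1),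
    mz r s = ∑' n : Tuple (r + 1), ∏ i, (n.1 i : ℂ) ^ (-s i) := by
  induction r with
  | zero =>
    intro s hs
    have h1 : 1 < (s 0).re := by
      simpa using last_lt_re (r := 0) (I := 0) (s := s) (by rwa [shiftRegion_zero])
    rw [mz, zeta_eq_tsum_one_div_nat_add_one_cpow h1, ← tupleOneEquiv.tsum_eq]
    refine tsum_congr fun n => ?_
    simp [tupleOneEquiv, Complex.cpow_neg]
  | succ r ih =>
    intro s hs
    rw [← shiftRegion_zero] at hs
    have h1 : s (Fin.last (r + 1)) - 1 ≠ 0 := fun h0 => by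
      have := last_lt_re hs
      rw [sub_eq_zero.1 h0] at this
      simp at this
    rw [mz_succ_of_tsum ih hs, emSum, Finset.range_zero, Finset.sum_empty, zero_add, remainder_eq,
      div_eq_iff h1, ← tsum_mul_right]
    refine tsum_congr fun n => ?_
    have := n.two_le_last
    rw [emTerm, if_neg (by omega), Fin.prod_univ_castSucc (n := r + 1)]
    simp only [Finset.range_zero, Finset.sum_empty, add_zero]
    ring

theorem mz_succ {I : ℕ} {s : Fin (r + 2) → ℂ} (hs : s ∈ shiftRegion (r + 1) I) :
    mz (r + 1) s = emSum r I s / (s (Fin.last (r + 1)) - 1) :=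
  mz_succ_of_tsum (mz_eq_tsum r) hs

theorem mz_succ_eventuallyEq {I : ℕ} {s : Fin (r + 2) → ℂ} (hs : s ∈ shiftRegion (r + 1) I) :
    mz (r + 1) =ᶠ[𝓝 s] fun s => emSum r I s / (s (Fin.last (r + 1)) - 1) :=
  Filter.mem_of_superset ((isOpen_shiftRegion _ _).mem_nhds hs) fun _ h => mz_succ h

/-- The points off the hyperplanes which may contain poles. -/
def IsRegular (s : Fin (r + 1) → ℂ) : Prop :=
  s (Fin.last r) ≠ 1 ∧
    ∀ j : Fin r, ∑ i ∈ Finset.Ici j.castSucc, s i ∉ Set.range ((↑) : ℤ → ℂ)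

/-- Merging moves tail sums by integers; excluding all integers, rather than the actual polar
values, makes regularity stable under it. -/
theorem IsRegular.merge {s : Fin (r + 2) → ℂ} (hs : IsRegular s) (i : ℕ) :
    IsRegular (merge i s) := by
  have key : ∀ j : Fin (r + 1), ∑ k ∈ Finset.Ici j, PolyZeta.merge i s k ∉
      Set.range ((↑) : ℤ → ℂ) := by
    rintro j ⟨m, hm⟩
    refine hs.2 j ⟨m + 1 - i, ?_⟩
    rw [sum_Ici_merge] at hm
    push_cast
    rw [hm]
    ring
  refine ⟨fun h => key (Fin.last r) ⟨1, ?_⟩, fun j => key j.castSucc⟩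
  have h' : Finset.Ici (Fin.last r) = {Fin.last r} := by ext; simp [Fin.last_le_iff]
  rw [h', Finset.sum_singleton, h]
  simp

theorem analyticAt_riemannZeta {s : ℂ} (hs : s ≠ 1) : AnalyticAt ℂ riemannZeta s := by
  have : DifferentiableOn ℂ riemannZeta {1}ᶜ := fun z hz =>
    (differentiableAt_riemannZeta hz).differentiableWithinAt
  exact this.analyticAt (isOpen_compl_singleton.mem_nhds hs)

theorem analyticAt_poch (i : ℕ) (s : Fin (r + 1) → ℂ) :
    AnalyticAt ℂ (fun s => bernoulliCoeff i * poch i (s (Fin.last r) - 1)) s := by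
  refine analyticAt_const.mul ?_
  exact AnalyticAt.fun_comp (f := fun s : Fin (r + 1) → ℂ => s (Fin.last r) - 1)
    ((differentiable_poch i).analyticAt _) ((analyticAt_apply _ s).sub analyticAt_const)

theorem IsRegular.analyticAt_mz {s : Fin (r + 1) → ℂ} (hs : IsRegular s) :
    AnalyticAt ℂ (mz r) s := by
  induction r with
  | zero =>
    exact AnalyticAt.fun_comp (f := fun s : Fin 1 → ℂ => s 0) (analyticAt_riemannZeta hs.1)
      (analyticAt_apply 0 s)
  | succ r ih =>
    obtain ⟨I, hI⟩ := exists_mem_shiftRegion s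
    refine AnalyticAt.congr ?_ (mz_succ_eventuallyEq hI).symm
    refine AnalyticAt.fun_div (AnalyticAt.add ?_ (analyticAt_remainder hI))
      ((analyticAt_apply _ s).sub analyticAt_const) (sub_ne_zero.2 hs.1)
    refine Finset.analyticAt_fun_sum _ fun i _ => (analyticAt_poch i s).mul ?_
    exact (ih (hs.merge i)).fun_comp (analyticAt_merge i s)

theorem exists_analyticAt_sub_one_mul_riemannZeta :
    ∃ h : ℂ → ℂ, AnalyticAt ℂ h 1 ∧ ∀ s, s ≠ 1 → h s = (s - 1) * riemannZeta s := by
  refine ⟨Function.update (fun s => (s - 1) * riemannZeta s) 1 1, ?_, fun s hs => by simp [hs]⟩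
  refine Complex.analyticAt_of_differentiable_on_punctured_nhds_of_continuousAt ?_ ?_
  · filter_upwards [self_mem_nhdsWithin] with z hz
    refine DifferentiableAt.congr_of_eventuallyEq (f := fun s => (s - 1) * riemannZeta s)
      (by have := differentiableAt_riemannZeta hz; fun_prop) ?_
    filter_upwards [isOpen_compl_singleton.mem_nhds hz] with w hw
    simp only [Function.update_of_ne hw]
  · rw [continuousAt_update_same]
    exact riemannZeta_residue_one

theorem isQuotientAt_inv_sub_one {m : ℕ} (i : Fin m) (s : Fin m → ℂ) :
    IsQuotientAt (fun s => (s i - 1)⁻¹) (fun _ => 1) (fun s => s i - 1) s := by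
  refine ⟨analyticAt_const, (analyticAt_apply i s).sub analyticAt_const, fun h => ?_,
    Eventually.of_forall fun y _ => (one_div _).symm⟩
  have h1 := (isOpenMap_eval (X := fun _ : Fin m => ℂ) i).image_mem_nhds h
  have h2 : {(1 : ℂ)} ∈ 𝓝 (s i) := by
    refine Filter.mem_of_superset h1 ?_
    rintro _ ⟨y, hy, rfl⟩
    exact sub_eq_zero.1 hy
  have h3 := mem_of_mem_nhds h2
  rw [Set.mem_singleton_iff] at h3
  rw [h3] at h2
  have : (𝓝[≠] (1 : ℂ)) = ⊥ := by
    rw [nhdsWithin, inf_principal_eq_bot]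
    simpa using h2
  exact NeBot.ne inferInstance this

theorem exists_isQuotientAt_mz (r : ℕ) (s : Fin (r + 1) → ℂ) :
    ∃ p q, IsQuotientAt (mz r) p q s := by
  induction r with
  | zero =>
    by_cases hs : s 0 = 1
    · obtain ⟨h, h1, h2⟩ := exists_analyticAt_sub_one_mul_riemannZeta
      obtain ⟨-, hq, hq0, -⟩ := isQuotientAt_inv_sub_one 0 s
      refine ⟨fun s => h (s 0), fun s => s 0 - 1, ?_, hq, hq0, Eventually.of_forall fun y hy => ?_⟩
      · exact AnalyticAt.fun_comp (f := fun s : Fin 1 → ℂ => s 0) (hs ▸ h1) (analyticAt_apply 0 s)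
      · dsimp only at hy ⊢
        rw [h2 _ (sub_ne_zero.1 hy), mul_div_cancel_left₀ _ hy, mz]
    · exact ⟨_, _, AnalyticAt.isQuotientAt (IsRegular.analyticAt_mz ⟨hs, fun j => j.elim0⟩)⟩
  | succ r ih =>
    obtain ⟨I, hI⟩ := exists_mem_shiftRegion s
    obtain ⟨p, q, h⟩ := exists_isQuotientAt_sum (x := s) (Finset.range I)
      (F := fun i s => bernoulliCoeff i * poch i (s (Fin.last (r + 1)) - 1) * mz r (merge i s))
      fun i _ => by
        obtain ⟨p, q, h⟩ := ih (merge i s)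
        exact ⟨_, _, (AnalyticAt.isQuotientAt (analyticAt_poch i s)).mul
          (h.comp (analyticAt_merge i s) (isOpenMap_merge i))⟩
    refine ⟨_, _, ((h.add (AnalyticAt.isQuotientAt (analyticAt_remainder hI))).mul
      (isQuotientAt_inv_sub_one (Fin.last (r + 1)) s)).congr ?_⟩
    filter_upwards [mz_succ_eventuallyEq hI] with y hy
    rw [hy, div_eq_mul_inv, emSum]

theorem analyticAt_mz_of_mem {s : Fin (r + 1) → ℂ} (hs : s ∈ convergenceRegion (r + 1)) :
    AnalyticAt ℂ (mz r) s := by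
  obtain ⟨η, hη, hc⟩ := (mem_convergenceRegion.1 hs).exists_sub
  have h := analyticAt_multiSum (a := fun (_ : Fin (r + 1)) n s => (n : ℂ) ^ (-s))
    (fun i n hn => differentiable_natCast_cpow (by omega) differentiable_neg) hc
    (s₀ := s) fun i => norm_cpow_neg_le (sub_lt_self (s i).re hη)
  refine h.congr ?_
  rw [← shiftRegion_zero] at hs
  filter_upwards [(isOpen_shiftRegion _ _).mem_nhds hs] with y hy
  rw [shiftRegion_zero] at hy
  exact (mz_eq_tsum r y hy).symm

theorem isMultipleZeta_normalize_mz (r : ℕ) : IsMultipleZeta (normalize (mz r)) where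
  meromorphic := isMeromorphic_normalize (exists_isQuotientAt_mz r)
  hasSum s hs := by
    rw [normalize_apply (AnalyticAt.hasExtension (analyticAt_mz_of_mem hs)), mz_eq_tsum r s hs]
    convert! (summable_zeta hs).hasSum using 2 with n
    simp [Complex.cpow_neg]

theorem IsMultipleZeta.eventuallyEq_mz {Z : (Fin (r + 1) → ℂ) → ℂ} (hZ : IsMultipleZeta Z)
    {s : Fin (r + 1) → ℂ} (hs : IsRegular s) : Z =ᶠ[𝓝 s] mz r := by
  -- The point `(2, …, 2)` lies in the region of convergence and serves as the base point where both
  -- functions are the series.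
  have h0 : (fun _ => 2 : Fin (r + 1) → ℂ) ∈ shiftRegion r 0 := fun j => by
    have : ((j : ℕ) : ℝ) < (r + 1 : ℕ) := by exact_mod_cast j.2
    simp only [Finset.sum_const, Fin.card_Ici, nsmul_eq_mul, Complex.re_ofNat, Complex.mul_re,
      Complex.natCast_re, Complex.natCast_im, Complex.im_ofNat]
    rw [Nat.cast_sub j.2.le]
    push_cast at this ⊢
    linarith
  refine hZ.meromorphic.eventuallyEq_of_analyticAt (exists_isQuotientAt_mz r)
    (x₀ := fun _ => 2) ?_ hs.analyticAt_mz
  filter_upwards [(isOpen_shiftRegion _ _).mem_nhds h0] with y hy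
  rw [shiftRegion_zero] at hy
  exact (hZ.hasSum y hy).unique ((isMultipleZeta_normalize_mz r).hasSum y hy) |>.trans
    (normalize_apply (AnalyticAt.hasExtension (analyticAt_mz_of_mem hy)))

end Continuation

/-! ### Iterated limits -/

/-- `P` holds for `s₁ ≠ a₁` near `a₁`, for `s₂ ≠ a₂` near `a₂` (depending on `s₁`), and so on. -/
def NestedEventually : (r : ℕ) → ((Fin r → ℂ) → Prop) → (Fin r → ℂ) → Prop
  | 0, P, a => P a
  | r + 1, P, a =>
    ∀ᶠ s in 𝓝[≠] (a 0), NestedEventually r (fun t => P (Fin.cons s t)) (Fin.tail a)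

theorem NestedEventually.mono {r : ℕ} {P Q : (Fin r → ℂ) → Prop} {a : Fin r → ℂ}
    (h : NestedEventually r P a) (hPQ : ∀ s, P s → Q s) : NestedEventually r Q a := by
  induction r with
  | zero => exact hPQ _ h
  | succ r ih => exact Eventually.mono h fun s hs => ih hs fun t => hPQ _

theorem NestedEventually.and {r : ℕ} {P Q : (Fin r → ℂ) → Prop} {a : Fin r → ℂ}
    (hP : NestedEventually r P a) (hQ : NestedEventually r Q a) :
    NestedEventually r (fun s => P s ∧ Q s) a := by
  induction r with
  | zero => exact ⟨hP, hQ⟩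
  | succ r ih =>
    filter_upwards [hP, hQ] with s h1 h2
    exact ih h1 h2

/-- The integers other than `c + a` form a closed set missing `c + a`; the value `c + a` itself is
excluded by the puncture. -/
theorem eventually_add_notMem_range_intCast (c a : ℂ) :
    ∀ᶠ s in 𝓝[≠] a, c + s ∉ Set.range ((↑) : ℤ → ℂ) := by
  have hT : IsClosed (((↑) : ℤ → ℂ) '' {m | (m : ℂ) ≠ c + a}) :=
    Complex.isClosedEmbedding_intCast.isClosedMap _ (isClosed_discrete _)
  have h1 : ∀ᶠ s in 𝓝 a, c + s ∉ ((↑) : ℤ → ℂ) '' {m | (m : ℂ) ≠ c + a} := by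
    refine (continuous_const.add continuous_id).continuousAt.eventually
      (hT.isOpen_compl.mem_nhds ?_)
    rintro ⟨m, hm, hm'⟩
    exact hm hm'
  filter_upwards [eventually_nhdsWithin_of_eventually_nhds h1, self_mem_nhdsWithin] with s h2 h3
  rintro ⟨m, hm⟩
  refine h2 ⟨m, ?_, hm⟩
  rw [Set.mem_ofPred_eq, hm]
  exact fun h => h3 (add_left_cancel h)

theorem nestedEventually_add_sum {r : ℕ} (c : ℂ) (a : Fin (r + 1) → ℂ) :
    NestedEventually (r + 1) (fun t => c + ∑ i, t i ∉ Set.range ((↑) : ℤ → ℂ)) a := by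
  induction r generalizing c with
  | zero =>
    filter_upwards [eventually_add_notMem_range_intCast c (a 0)] with s hs
    simpa [NestedEventually] using hs
  | succ r ih =>
    refine Eventually.of_forall fun s => (ih (c + s) (Fin.tail a)).mono fun t ht => ?_
    simpa [Fin.sum_univ_succ (n := r + 1), ← add_assoc] using ht

theorem nestedEventually_sum_Ici {r : ℕ} (a : Fin r → ℂ) :
    NestedEventually r
      (fun t => ∀ j, ∑ i ∈ Finset.Ici j, t i ∉ Set.range ((↑) : ℤ → ℂ)) a := by
  induction r with
  | zero => exact fun j => j.elim0
  | succ r ih =>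
    filter_upwards [nestedEventually_add_sum 0 a] with s hs
    refine (hs.and (ih (Fin.tail a))).mono fun t ht => Fin.forall_fin_succ.2 ⟨?_, fun j => ?_⟩
    · rw [show Finset.Ici (0 : Fin (r + 1)) = Finset.univ by ext; simp]
      simpa using ht.1
    · rw [sum_Ici_succ]
      exact ht.2 j

theorem HasIteratedLimit.add {r : ℕ} {f f' : (Fin r → ℂ) → ℂ} {a : Fin r → ℂ} {L L' : ℂ}
    (h : HasIteratedLimit r f a L) (h' : HasIteratedLimit r f' a L') :
    HasIteratedLimit r (fun s => f s + f' s) a (L + L') := by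
  induction r generalizing L L' with
  | zero => exact congrArg₂ (· + ·) h h'
  | succ r ih =>
    obtain ⟨g, h1, h2⟩ := h
    obtain ⟨g', h1', h2'⟩ := h'
    refine ⟨fun s => g s + g' s, ?_, h2.add h2'⟩
    filter_upwards [h1, h1'] with s h3 h4
    exact ih h3 h4

theorem HasIteratedLimit.const_mul {r : ℕ} {f : (Fin r → ℂ) → ℂ} {a : Fin r → ℂ} {L : ℂ}
    (h : HasIteratedLimit r f a L) (c : ℂ) : HasIteratedLimit r (fun s => c * f s) a (c * L) := by
  induction r generalizing L with
  | zero => exact congrArg (c * ·) h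
  | succ r ih =>
    obtain ⟨g, h1, h2⟩ := h
    refine ⟨fun s => c * g s, ?_, h2.const_mul c⟩
    filter_upwards [h1] with s h3
    exact ih h3

theorem hasIteratedLimit_const (r : ℕ) (a : Fin r → ℂ) (c : ℂ) :
    HasIteratedLimit r (fun _ => c) a c := by
  induction r with
  | zero => rfl
  | succ r ih => exact ⟨fun _ => c, Eventually.of_forall fun _ => ih _, tendsto_const_nhds⟩

theorem hasIteratedLimit_sum {ι : Type*} {r : ℕ} (t : Finset ι) {f : ι → (Fin r → ℂ) → ℂ}
    {a : Fin r → ℂ} {L : ι → ℂ} (h : ∀ i ∈ t, HasIteratedLimit r (f i) a (L i)) :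
    HasIteratedLimit r (fun s => ∑ i ∈ t, f i s) a (∑ i ∈ t, L i) := by
  classical
  induction t using Finset.induction_on with
  | empty => simpa using hasIteratedLimit_const r a 0
  | insert i t hi ih =>
    simp only [Finset.sum_insert hi]
    exact (h i (Finset.mem_insert_self i t)).add
      (ih fun j hj => h j (Finset.mem_insert_of_mem hj))

theorem HasIteratedLimit.comp_add_right {r : ℕ} {f : (Fin r → ℂ) → ℂ} {a v : Fin r → ℂ} {L : ℂ}
    (h : HasIteratedLimit r f (a + v) L) : HasIteratedLimit r (fun s => f (s + v)) a L := by
  induction r generalizing L with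
  | zero => exact h
  | succ r ih =>
    obtain ⟨g, h1, h2⟩ := h
    have hv : Tendsto (fun s => s + v 0) (𝓝[≠] (a 0)) (𝓝[≠] ((a + v) 0)) := by
      refine tendsto_nhdsWithin_iff.2 ⟨?_, ?_⟩
      · exact ((continuous_id.add continuous_const).tendsto (a 0)).mono_left nhdsWithin_le_nhds
      · filter_upwards [self_mem_nhdsWithin] with s hs h
        exact hs (add_right_cancel h)
    refine ⟨fun s => g (s + v 0), ?_, h2.comp hv⟩
    filter_upwards [hv.eventually h1] with s hs
    have h3 := ih (a := Fin.tail a) (v := Fin.tail v) hs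
    convert! h3 using 3 with t
    funext i
    refine Fin.cases ?_ (fun j => ?_) i <;> simp [Fin.tail]

/-- Iterated limits are defined by peeling off the outermost variable; this peels off the innermost
one, as the recursion in the last entry requires. -/
theorem hasIteratedLimit_snoc {r : ℕ} {f : (Fin (r + 1) → ℂ) → ℂ} {F : (Fin r → ℂ) → ℂ}
    {a : Fin r → ℂ} {b L : ℂ}
    (h : NestedEventually r
      (fun s => Tendsto (fun x => f (Fin.snoc s x)) (𝓝[≠] b) (𝓝 (F s))) a)
    (hF : HasIteratedLimit r F a L) : HasIteratedLimit (r + 1) f (Fin.snoc a b) L := by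
  induction r generalizing L with
  | zero =>
    refine ⟨fun x => f (Fin.snoc a x), Eventually.of_forall fun s => ?_, ?_⟩
    · refine congrArg f (funext fun i => ?_)
      rw [Fin.fin_one_eq_zero i]
      rfl
    · have hL : F a = L := hF
      rw [← hL]
      exact h
  | succ r ih =>
    obtain ⟨g, h1, h2⟩ := hF
    have h0 : (Fin.snoc a b : Fin (r + 2) → ℂ) 0 = a 0 :=
      Fin.snoc_castSucc (α := fun _ => ℂ) _ _ (0 : Fin (r + 1))
    have ht : Fin.tail (Fin.snoc a b : Fin (r + 2) → ℂ) = Fin.snoc (Fin.tail a) b := by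
      funext i
      refine Fin.lastCases ?_ (fun j => ?_) i
      · rw [Fin.snoc_last (α := fun _ => ℂ)]
        exact Fin.snoc_last (α := fun _ => ℂ) _ _
      · rw [Fin.snoc_castSucc (α := fun _ => ℂ)]
        exact Fin.snoc_castSucc (α := fun _ => ℂ) _ _ j.succ
    refine ⟨g, ?_, by rwa [h0]⟩
    rw [h0, ht]
    filter_upwards [h, h1] with s h3 h4
    refine ih (h3.mono fun t h5 => ?_) h4
    simpa only [Fin.cons_snoc_eq_snoc_cons] using h5

/-! ### Values at non-positive integers -/

theorem merge_snoc {r : ℕ} (i : ℕ) (s : Fin (r + 1) → ℂ) (x : ℂ) :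
    merge i (Fin.snoc s x : Fin (r + 2) → ℂ) =
      s + fun j => if j = Fin.last r then x - 1 + i else 0 := by
  funext j
  rw [merge, Fin.snoc_castSucc (α := fun _ => ℂ), Fin.snoc_last (α := fun _ => ℂ)]
  rfl

theorem isRegular_snoc {r : ℕ} {s : Fin r → ℂ}
    (hs : ∀ j, ∑ i ∈ Finset.Ici j, s i ∉ Set.range ((↑) : ℤ → ℂ)) (b : ℕ) :
    IsRegular (Fin.snoc s (-(b : ℂ)) : Fin (r + 1) → ℂ) := by
  refine ⟨?_, fun j => ?_⟩
  · rw [Fin.snoc_last (α := fun _ => ℂ)]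
    intro h
    have h1 : ((b + 1 : ℕ) : ℂ) = 0 := by push_cast; linear_combination -h
    exact Nat.succ_ne_zero b (by exact_mod_cast h1)
  · rintro ⟨m, hm⟩
    refine hs j ⟨m + b, ?_⟩
    rw [sum_Ici_castSucc] at hm
    simp only [Fin.snoc_castSucc (α := fun _ => ℂ), Fin.snoc_last (α := fun _ => ℂ)] at hm
    push_cast
    rw [hm]
    ring

theorem tendsto_snoc_of_isRegular {r : ℕ} {f : (Fin (r + 1) → ℂ) → ℂ}
    (hf : ∀ s, IsRegular s → f =ᶠ[𝓝 s] mz r) {s : Fin r → ℂ} {x : ℂ}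
    (hs : IsRegular (Fin.snoc s x : Fin (r + 1) → ℂ)) :
    Tendsto (fun y => f (Fin.snoc s y)) (𝓝[≠] x) (𝓝 (mz r (Fin.snoc s x))) := by
  have h1 : Tendsto f (𝓝 (Fin.snoc s x)) (𝓝 (mz r (Fin.snoc s x))) :=
    hs.analyticAt_mz.continuousAt.tendsto.congr' (hf _ hs).symm
  have h2 : Continuous fun y : ℂ => (Fin.snoc s y : Fin (r + 1) → ℂ) :=
    continuous_pi fun i => by
      refine Fin.lastCases ?_ (fun j => ?_) i
      · simp only [Fin.snoc_last (α := fun _ => ℂ)]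
        exact continuous_id
      · simp only [Fin.snoc_castSucc (α := fun _ => ℂ)]
        exact continuous_const
  exact (h1.comp (h2.tendsto x)).mono_left nhdsWithin_le_nhds

/-- Any order `I ≥ b + 2` makes the remainder vanish, and the terms beyond `i = b + 1` vanish with
their Pochhammer factor. -/
theorem mz_snoc_neg_natCast {r : ℕ} (s : Fin (r + 1) → ℂ) (b : ℕ) :
    mz (r + 1) (Fin.snoc s (-(b : ℂ))) = (-(b : ℂ) - 1)⁻¹ * ∑ i ∈ Finset.range (b + 2),
      bernoulliCoeff i * poch i (-(b : ℂ) - 1) *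
        mz r (s + fun j => if j = Fin.last r then -(b : ℂ) - 1 + i else 0) := by
  obtain ⟨I, hI⟩ := exists_mem_shiftRegion (Fin.snoc s (-(b : ℂ)) : Fin (r + 2) → ℂ)
  have hI' := shiftRegion_mono (r + 1) (le_max_left I (b + 2)) hI
  have hb : b + 2 ≤ max I (b + 2) := le_max_right _ _
  have hrem : remainder (r + 1) (max I (b + 2)) (Fin.snoc s (-(b : ℂ))) = 0 := by
    rw [remainder_eq]
    simp only [Fin.snoc_last (α := fun _ => ℂ), emTerm_neg_natCast hb, mul_zero, tsum_zero]
  rw [mz_succ hI', emSum, hrem, add_zero, div_eq_inv_mul]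
  simp only [Fin.snoc_last (α := fun _ => ℂ), merge_snoc]
  rw [← Finset.sum_subset (Finset.range_subset_range.2 hb)]
  intro i _ hi
  have hlt : b + 1 < i := by rw [Finset.mem_range] at hi; omega
  rw [show -(b : ℂ) - 1 = -((b + 1 : ℕ) : ℂ) by push_cast; ring, poch_neg_natCast,
    Nat.descFactorial_of_lt hlt]
  simp

/-- After division by `-b - 1`, the index `i = 0` gives the coefficient `-1/(b + 1)`, `i = 1` gives
`B_1 = -1/2`, and `i = q + 1` gives the `q`-th summand, by `(-b - 1)_{q+1} = (-b - 1)(-b)_q`. -/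
theorem nmbp_succ_eval_one {r : ℕ} (k : Fin (r + 2) → ℕ) {a b : ℕ}
    (ha : k (Fin.last r).castSucc = a) (hb : k (Fin.last (r + 1)) = b) :
    (((nmbp (r + 1) k).eval 1 : ℚ) : ℂ) = (-(b : ℂ) - 1)⁻¹ * ∑ i ∈ Finset.range (b + 2),
      bernoulliCoeff i * poch i (-(b : ℂ) - 1) *
        (((nmbp r (Fin.snoc (Fin.init (Fin.init k)) (a + b + 1 - i))).eval 1 : ℚ) : ℂ) := by
  have hb0 : -(b : ℂ) - 1 ≠ 0 := by
    have : ((b + 1 : ℕ) : ℂ) ≠ 0 := by exact_mod_cast b.succ_ne_zero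
    push_cast at this
    intro h
    exact this (by linear_combination -h)
  have hb1 : (b : ℂ) + 1 ≠ 0 := fun h => hb0 (by linear_combination -h)
  have hpoch : ∀ q, (((ascPochhammer ℚ q).eval (-(b : ℚ)) : ℚ) : ℂ) = poch q (-(b : ℂ)) := fun q => by
    rw [poch_neg_natCast, ascPochhammer_eval_neg_eq_descPochhammer,
      descPochhammer_eval_eq_descFactorial]
    push_cast
    rfl
  have hsum : ∑ q ∈ Finset.Icc 1 b, (ascPochhammer ℚ q).eval (-(b : ℚ)) *
      (_root_.bernoulli (q + 1) / (q + 1).factorial) *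
        (nmbp r (Fin.snoc (Fin.init (Fin.init k)) (a + b - q))).eval 1 =
      ∑ i ∈ Finset.range b, (ascPochhammer ℚ (i + 1)).eval (-(b : ℚ)) *
      (_root_.bernoulli (i + 1 + 1) / (i + 1 + 1).factorial) *
        (nmbp r (Fin.snoc (Fin.init (Fin.init k)) (a + b - (i + 1)))).eval 1 := by
    rw [Finset.range_eq_Ico, Finset.sum_Ico_add' (fun q => (ascPochhammer ℚ q).eval (-(b : ℚ)) *
      (_root_.bernoulli (q + 1) / (q + 1).factorial) *
        (nmbp r (Fin.snoc (Fin.init (Fin.init k)) (a + b - q))).eval 1) 0 b 1]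
    exact Finset.sum_congr (by ext; simp) fun _ _ => rfl
  rw [nmbp]
  simp only [ha, hb, eval_add, eval_sub, eval_mul, eval_C, eval_finsetSum]
  rw [hsum, Finset.sum_range_succ', Finset.sum_range_succ', eq_inv_mul_iff_mul_eq₀ hb0]
  push_cast
  simp only [hpoch]
  have hterm : ∀ i : ℕ, bernoulliCoeff (i + 1 + 1) * poch (i + 1 + 1) (-(b : ℂ) - 1) *
      (((nmbp r (Fin.snoc (Fin.init (Fin.init k)) (a + b - (i + 1)))).eval 1 : ℚ) : ℂ) =
      (-(b : ℂ) - 1) * (poch (i + 1) (-(b : ℂ)) *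
        ((_root_.bernoulli (i + 1 + 1) : ℂ) / ((i + 1 + 1).factorial : ℂ)) *
      (((nmbp r (Fin.snoc (Fin.init (Fin.init k)) (a + b - (i + 1)))).eval 1 : ℚ) : ℂ)) := fun i => by
    rw [poch_succ (i + 1), sub_add_cancel, bernoulliCoeff]
    push_cast
    ring
  rw [Finset.sum_congr rfl fun i _ => hterm i, ← Finset.mul_sum]
  generalize (∑ i ∈ Finset.range b, poch (i + 1) (-(b : ℂ)) * _ * _ : ℂ) = S
  simp only [poch_succ 0, poch_zero, bernoulliCoeff, _root_.bernoulli_zero, _root_.bernoulli_one,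
    Nat.factorial_zero, Nat.factorial_one]
  push_cast
  field_simp
  ring

theorem hasIteratedLimit_of_eq_mz {r : ℕ} (k : Fin (r + 1) → ℕ) {f : (Fin (r + 1) → ℂ) → ℂ}
    (hf : ∀ s, IsRegular s → f =ᶠ[𝓝 s] mz r) {L : ℂ}
    (h : HasIteratedLimit r (fun s => mz r (Fin.snoc s (-(k (Fin.last r) : ℂ))))
      (fun i => -(k i.castSucc : ℂ)) L) :
    HasIteratedLimit (r + 1) f (fun i => -(k i : ℂ)) L := by
  have hsnoc : (fun i => -(k i : ℂ)) = Fin.snoc (α := fun _ => ℂ)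
      (fun i : Fin r => -(k i.castSucc : ℂ)) (-(k (Fin.last r) : ℂ)) := by
    funext i
    refine Fin.lastCases ?_ (fun j => ?_) i
    · rw [Fin.snoc_last (α := fun _ => ℂ)]
    · rw [Fin.snoc_castSucc (α := fun _ => ℂ)]
  rw [hsnoc]
  exact hasIteratedLimit_snoc ((nestedEventually_sum_Ici _).mono fun s hs =>
      tendsto_snoc_of_isRegular hf (isRegular_snoc hs _)) h

/-- Letting `f` be any function that agrees with `mz` near regular points covers both an arbitrary
continuation and `mz` itself, to which the induction hypothesis is applied. -/
theorem hasIteratedLimit_mz (r : ℕ) (k : Fin (r + 1) → ℕ) {f : (Fin (r + 1) → ℂ) → ℂ}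
    (hf : ∀ s, IsRegular s → f =ᶠ[𝓝 s] mz r) :
    HasIteratedLimit (r + 1) f (fun i => -(k i : ℂ)) (((nmbp r k).eval 1 : ℚ) : ℂ) := by
  induction r with
  | zero =>
    refine hasIteratedLimit_of_eq_mz k hf ?_
    change riemannZeta (-(k 0 : ℂ)) = _
    rw [riemannZeta_neg_nat_eq_bernoulli', nmbp, eval_mul, eval_C, Polynomial.bernoulli_eval_one]
    push_cast
    ring
  | succ r ih =>
    refine hasIteratedLimit_of_eq_mz k hf ?_
    rw [nmbp_succ_eval_one k rfl rfl]
    simp only [mz_snoc_neg_natCast]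
    refine (hasIteratedLimit_sum _ fun i hi => ?_).const_mul _
    refine (HasIteratedLimit.comp_add_right (f := mz r) ?_).const_mul _
    -- The translated last coordinate is `-a + (-b - 1 + i) = -(a + b + 1 - i)`, again a
    -- non-positive integer because `i ≤ b + 1`.
    convert! ih (Fin.snoc (Fin.init (Fin.init k)) (k (Fin.last r).castSucc + k (Fin.last (r + 1)) + 1 - i))
      (f := mz r) fun _ _ => .rfl using 1
    have hi' : i ≤ k (Fin.last r).castSucc + k (Fin.last (r + 1)) + 1 := by
      have := Finset.mem_range.1 hi
      omega
    funext j
    refine Fin.lastCases ?_ (fun j => ?_) j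
    · rw [Fin.snoc_last (α := fun _ => ℕ), Nat.cast_sub hi']
      simp
      ring
    · rw [Fin.snoc_castSucc (α := fun _ => ℕ)]
      simp [Fin.init, (Fin.castSucc_lt_last j).ne]

end PolyZeta

theorem theoremE (r : ℕ) (k : Fin (r + 1) → ℕ) :
    (∃ Z : (Fin (r + 1) → ℂ) → ℂ, PolyZeta.IsMultipleZeta Z) ∧
    ∀ Z : (Fin (r + 1) → ℂ) → ℂ, PolyZeta.IsMultipleZeta Z →
      PolyZeta.HasIteratedLimit (r + 1) Z (fun i => -(k i : ℂ))
        (((PolyZeta.nmbp r k).eval 1 : ℚ) : ℂ) :=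
  ⟨⟨_, PolyZeta.isMultipleZeta_normalize_mz r⟩,
    fun _ hZ => PolyZeta.hasIteratedLimit_mz r k fun _ hs => hZ.eventuallyEq_mz hs⟩
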